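/- Graphs are connected, locally finite (possibly finite), non-empty, without loops or multiple edges. Let $\mathrm{Gr}_\bullet$ be the space of isomorphism classes $\overline{(\Gamma,x)}$ of rooted graphs, with the projective limit topology (a sequence converges if and only if, for every $r$, the rooted balls of radius $r$ around the roots stabilize up to isomorphism). Let $\mathrm{Gr}_{\bullet\bullet}$ be the space of isomorphism classes $\overline{(\Gamma,x,y)}$ of graphs with an ordered pair of roots, topologized in the same way by the balls around the primary root $x$ (marked with the secondary root $y$ when it lies in the ball). Both carry their Borel $\sigma$-fields. Let $\mathcal R\subset \mathrm{Gr}_\bullet\times \mathrm{Gr}_\bullet$ be the root-moving equivalence relation, consisting of all pairs $(\overline{(\Gamma,x)},\overline{(\Gamma,y)})$, let $\sigma:\mathrm{Gr}_{\bullet\bullet}\to\mathcal R$ be the map $\overline{(\Gamma,x,y)}\mapsto(\overline{(\Gamma,x)},\overline{(\Gamma,y)})$, and let $j(\xi,\eta)=(\eta,\xi)$ on $\mathcal R$ and $J\,\overline{(\Gamma,x,y)}=\overline{(\Gamma,y,x)}$ on $\mathrm{Gr}_{\bullet\bullet}$. Let $\mu$ be a $\sigma$-finite Borel measure on $\mathrm{Gr}_\bullet$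 (for example, a probability measure). Define measures on $\mathcal R$ and on $\mathrm{Gr}_{\bullet\bullet}$ by $$M_{\mathcal R}=\int \sum_{\eta\in\mathcal R[\xi]}\delta_{(\xi,\eta)}\,d\mu(\xi),\qquad M_{\bullet\bullet}=\int \nu_\xi\,d\mu(\xi),\qquad \nu_{\overline{(\Gamma,x)}}=\sum_{y\in\Gamma}\delta_{\overline{(\Gamma,x,y)}} .$$ The measure $\mu$ is called *unimodular* if $J_*M_{\bullet\bullet}=M_{\bullet\bullet}$. It is called *quasi-invariant* with respect to $\mathcal R$ if the measures $j_*M_{\mathcal R}$ and $M_{\mathcal R}$ are equivalent (mutually absolutely continuous), and then its *Radon–Nikodym cocycle* is $\Delta_\mu=\dfrac{d\,j_*M_{\mathcal R}}{d\,M_{\mathcal R}}$. For a graph $\Gamma$ let $G=\mathrm{Aut}(\Gamma)$, with the (locally compact) topology of pointwise convergence, let $G_x$ be the stabilizer of the vertex $x$, and put $\Delta_\Gamma(x,y)=\dfrac{\operatorname{card} G_x y}{\operatorname{card} G_y x}$. Let $\breve{\mathrm{Gr}}_\bullet\subset\mathrm{Gr}_\bullet$ be the set of all rootings of graphs $\Gamma$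 such that the group $\mathrm{Aut}(\Gamma)$ is unimodular (that is, has a bi-invariant Haar measure). Over $\breve{\mathrm{Gr}}_\bullet$ the function $\overline{(\Gamma,x,y)}\mapsto\Delta_\Gamma(x,y)$ is constant on the fibres of $\sigma$, hence descends to a function $\Delta_\bullet$ on the restriction of $\mathcal R$ to $\breve{\mathrm{Gr}}_\bullet$, called the *modular cocycle*. **Theorem.** The measure $\mu$ is unimodular if and only if 1. $\mu$ is concentrated on $\breve{\mathrm{Gr}}_\bullet$, 2. $\mu$ is quasi-invariant with respect to $\mathcal R$, and 3. $\Delta_\mu=\Delta_\bullet$ holds $M_{\mathcal R}$-almost everywhere on the restriction of $\mathcal R$ to $\breve{\mathrm{Gr}}_\bullet$. -/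

import Mathlib

open MeasureTheory
open scoped ENNReal

namespace RandomGraph

/-! ### Automorphism groups -/

section Aut

variable {V : Type} (Γ : SimpleGraph V)

/-- The topology of pointwise convergence on the automorphism group of a graph
(the vertex set being discrete). -/
instance autTopology : TopologicalSpace (Γ ≃g Γ) :=
  TopologicalSpace.induced (fun (g : Γ ≃g Γ) (v : V) => g v)
    (@Pi.topologicalSpace V (fun _ => V) (fun _ => ⊥))

instance autMeasurableSpace : MeasurableSpace (Γ ≃g Γ) := borel _

instance autBorelSpace : BorelSpace (Γ ≃g Γ) := ⟨rfl⟩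

/-- The stabilizer orbit `G_x y`, where `G` is the automorphism group of the graph. -/
def stabOrbit (x y : V) : Set V := {z | ∃ g : Γ ≃g Γ, g x = x ∧ g y = z}

/-- The modular cocycle of a graph, `Δ_Γ(x, y) = card (G_x y) / card (G_y x)`. For a connected
locally finite graph both cardinalities are finite and positive. -/
noncomputable def graphModularCocycle (x y : V) : ℝ≥0∞ :=
  ((stabOrbit Γ x y).ncard : ℝ≥0∞) / ((stabOrbit Γ y x).ncard : ℝ≥0∞)

end Aut

/-- A (locally compact) group is unimodular if it has a left Haar measure that is also
right invariant. -/
def IsUnimodularGroup (G : Type) [Group G] [TopologicalSpace G] [MeasurableSpace G] : Prop :=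
  ∃ m : Measure G, m.IsHaarMeasure ∧ m.IsMulRightInvariant

/-! ### Rooted and doubly rooted graphs -/

/-- A connected locally finite graph, without loops or multiple edges. -/
structure LFGraph where
  V : Type
  graph : SimpleGraph V
  connected : graph.Connected
  locallyFinite : ∀ v, (graph.neighborSet v).Finite

structure RootedGraph extends LFGraph where
  root : V

structure DoublyRootedGraph extends LFGraph where
  root : V
  root₂ : V

instance RootedGraph.setoid : Setoid RootedGraph where
  r G H := ∃ φ : G.graph ≃g H.graph, φ G.root = H.root
  iseqv :=
    { refl := fun _ => ⟨SimpleGraph.Iso.refl, rfl⟩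
      symm := fun ⟨φ, h⟩ => ⟨φ.symm, by rw [← h]; exact φ.symm_apply_apply _⟩
      trans := fun ⟨φ, h⟩ ⟨ψ, k⟩ => ⟨φ.trans ψ, by rw [← k, ← h]; rfl⟩ }

instance DoublyRootedGraph.setoid : Setoid DoublyRootedGraph where
  r G H := ∃ φ : G.graph ≃g H.graph, φ G.root = H.root ∧ φ G.root₂ = H.root₂
  iseqv :=
    { refl := fun _ => ⟨SimpleGraph.Iso.refl, rfl, rfl⟩
      symm := fun ⟨φ, h, h'⟩ => ⟨φ.symm, by rw [← h]; exact φ.symm_apply_apply _,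
        by rw [← h']; exact φ.symm_apply_apply _⟩
      trans := fun ⟨φ, h, h'⟩ ⟨ψ, k, k'⟩ =>
        ⟨φ.trans ψ, by rw [← k, ← h]; rfl, by rw [← k', ← h']; rfl⟩ }

/-- The space of isomorphism classes of rooted locally finite connected graphs. -/
def Gr₁ : Type 1 := Quotient RootedGraph.setoid

/-- The space of isomorphism classes of doubly rooted locally finite connected graphs. -/
def Gr₂ : Type 1 := Quotient DoublyRootedGraph.setoid

/-- The isomorphism class of `(Γ, x)`. -/
def cls₁ (Γ : LFGraph) (x : Γ.V) : Gr₁ := Quotient.mk _ ⟨Γ, x⟩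

/-- The isomorphism class of `(Γ, x, y)`. -/
def cls₂ (Γ : LFGraph) (x y : Γ.V) : Gr₂ := Quotient.mk _ ⟨Γ, x, y⟩

theorem cls₁_map {Γ Γ' : LFGraph} (φ : Γ.graph ≃g Γ'.graph) (x : Γ.V) :
    cls₁ Γ x = cls₁ Γ' (φ x) :=
  Quotient.sound ⟨φ, rfl⟩

theorem cls₂_map {Γ Γ' : LFGraph} (φ : Γ.graph ≃g Γ'.graph) (x y : Γ.V) :
    cls₂ Γ x y = cls₂ Γ' (φ x) (φ y) :=
  Quotient.sound ⟨φ, rfl, rfl⟩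

/-! ### Topology and Borel structure -/

/-- The graph metric ball of radius `r` around `x`, as a set of vertices. -/
def LFGraph.ball (Γ : LFGraph) (x : Γ.V) (r : ℕ) : Set Γ.V := {v | Γ.graph.dist x v ≤ r}

/-- The balls of radius `r` around the roots are isomorphic as rooted graphs. -/
def BallIso₁ (r : ℕ) (G H : RootedGraph) : Prop :=
  ∃ φ : G.graph.induce (G.ball G.root r) ≃g H.graph.induce (H.ball H.root r),
    ∀ u : G.ball G.root r, (u : G.V) = G.root ↔ (φ u : H.V) = H.root

/-- The balls of radius `r` around the primary roots are isomorphic as rooted graphs, by an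
isomorphism that also respects the secondary root (if it lies in the ball). -/
def BallIso₂ (r : ℕ) (G H : DoublyRootedGraph) : Prop :=
  ∃ φ : G.graph.induce (G.ball G.root r) ≃g H.graph.induce (H.ball H.root r),
    (∀ u : G.ball G.root r, (u : G.V) = G.root ↔ (φ u : H.V) = H.root) ∧
    (∀ u : G.ball G.root r, (u : G.V) = G.root₂ ↔ (φ u : H.V) = H.root₂)

/-- The projective limit topology: its basic open sets are the classes of rooted graphs whose
ball of a given radius around the root is isomorphic to a given one. -/
instance : TopologicalSpace Gr₁ :=
  TopologicalSpace.generateFrom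
    {U | ∃ (G : RootedGraph) (r : ℕ),
      U = {ξ | ∃ H : RootedGraph, BallIso₁ r G H ∧ cls₁ H.toLFGraph H.root = ξ}}

instance : TopologicalSpace Gr₂ :=
  TopologicalSpace.generateFrom
    {U | ∃ (G : DoublyRootedGraph) (r : ℕ),
      U = {θ | ∃ H : DoublyRootedGraph,
        BallIso₂ r G H ∧ cls₂ H.toLFGraph H.root H.root₂ = θ}}

instance : MeasurableSpace Gr₁ := borel _
instance : BorelSpace Gr₁ := ⟨rfl⟩
instance : MeasurableSpace Gr₂ := borel _
instance : BorelSpace Gr₂ := ⟨rfl⟩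

/-! ### The root moving equivalence relation -/

/-- The root moving equivalence relation: two classes are equivalent if they are rootings of one
and the same graph. -/
def rootMoving : Setoid Gr₁ where
  r ξ η := ∃ (Γ : LFGraph) (x y : Γ.V), cls₁ Γ x = ξ ∧ cls₁ Γ y = η
  iseqv :=
    { refl := fun ξ => Quotient.inductionOn ξ fun G => ⟨G.toLFGraph, G.root, G.root, rfl, rfl⟩
      symm := fun ⟨Γ, x, y, hx, hy⟩ => ⟨Γ, y, x, hy, hx⟩
      trans := by
        rintro _ _ _ ⟨Γ, x, y, rfl, rfl⟩ ⟨Γ', y', z, h, rfl⟩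
        obtain ⟨φ, -⟩ := Quotient.exact h
        exact ⟨Γ, x, φ z, rfl, (cls₁_map φ z).symm⟩ }

/-- The equivalence relation as a subset of `Gr₁ × Gr₁`, with the induced Borel structure. -/
abbrev RelSpace : Type 1 := {p : Gr₁ × Gr₁ // rootMoving p.1 p.2}

/-- The involution `(ξ, η) ↦ (η, ξ)` of the equivalence relation. -/
def relSwap (p : RelSpace) : RelSpace := ⟨p.1.swap, rootMoving.symm p.2⟩

/-- The involution of the space of doubly rooted graphs that exchanges the two roots. -/
def rootSwap : Gr₂ → Gr₂ :=
  Quotient.lift (fun G : DoublyRootedGraph => cls₂ G.toLFGraph G.root₂ G.root)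
    (fun _ _ ⟨φ, h, h'⟩ => Quotient.sound ⟨φ, h', h⟩)

/-- The map sending the class of `(Γ, x, y)` to the pair of the classes of `(Γ, x)`
and `(Γ, y)`. -/
def sigma : Gr₂ → RelSpace :=
  Quotient.lift
    (fun G : DoublyRootedGraph =>
      (⟨(cls₁ G.toLFGraph G.root, cls₁ G.toLFGraph G.root₂),
        G.toLFGraph, G.root, G.root₂, rfl, rfl⟩ : RelSpace))
    (fun _ _ ⟨φ, h, h'⟩ =>
      Subtype.ext (Prod.ext (Quotient.sound ⟨φ, h⟩) (Quotient.sound ⟨φ, h'⟩)))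

/-! ### Fibre measures and counting measures -/

/-- The counting measure `N_ξ` on the fibre `{ξ} × R[ξ]` of the first projection of the
equivalence relation. -/
noncomputable def fibreCount (ξ : Gr₁) : Measure RelSpace :=
  Measure.sum fun η : {η : Gr₁ // rootMoving ξ η} => Measure.dirac ⟨(ξ, η.1), η.2⟩

/-- For `ξ` the class of `(Γ, x)`, the image of the counting measure on the vertex set of `Γ` under
the map sending `y` to the class of `(Γ, x, y)`. It gives that class the mass `card (G_x y)`. -/
noncomputable def fibreVertexCount : Gr₁ → Measure Gr₂ :=
  Quotient.lift
    (fun G : RootedGraph => Measure.sum fun y : G.V => Measure.dirac (cls₂ G.toLFGraph G.root y))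
    (by
      rintro G H ⟨φ, h⟩
      have e : ∀ y : G.V, cls₂ G.toLFGraph G.root y = cls₂ H.toLFGraph H.root (φ y) := by
        intro y
        rw [cls₂_map φ, h]
      ext s hs
      simp only [Measure.sum_apply _ hs, e]
      exact φ.toEquiv.tsum_eq
        (fun y => Measure.dirac (cls₂ H.toLFGraph H.root y) s))

/-- The counting measure `∫ N_ξ dμ(ξ)` on the equivalence relation. -/
noncomputable def relCountingMeasure (μ : Measure Gr₁) : Measure RelSpace :=
  μ.bind fibreCount

/-- The counting measure on the space of doubly rooted graphs: the integral against `μ` of the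
fibre measures `fibreVertexCount`. -/
noncomputable def doubleCountingMeasure (μ : Measure Gr₁) : Measure Gr₂ :=
  μ.bind fibreVertexCount

/-- A measure is unimodular if its counting measure on the space of doubly rooted graphs is
invariant under the exchange of the roots. -/
def IsUnimodular (μ : Measure Gr₁) : Prop :=
  (doubleCountingMeasure μ).map rootSwap = doubleCountingMeasure μ

/-- A measure is quasi-invariant if its counting measure on the equivalence relation is equivalent
to its image under the involution. -/
def IsQuasiInvariant (μ : Measure Gr₁) : Prop :=
  (relCountingMeasure μ).map relSwap ≪ relCountingMeasure μ ∧
    relCountingMeasure μ ≪ (relCountingMeasure μ).map relSwap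

/-- The Radon-Nikodym cocycle `dμ(η) / dμ(ξ)` of a quasi-invariant measure. -/
noncomputable def radonNikodymCocycle (μ : Measure Gr₁) : RelSpace → ℝ≥0∞ :=
  ((relCountingMeasure μ).map relSwap).rnDeriv (relCountingMeasure μ)

/-! ### The modular cocycle -/

theorem stabOrbit_map {V W : Type} {Γ : SimpleGraph V} {Γ' : SimpleGraph W} (φ : Γ ≃g Γ')
    (x y : V) : stabOrbit Γ' (φ x) (φ y) = φ '' stabOrbit Γ x y := by
  ext z
  constructor
  · rintro ⟨g, hx, hy⟩
    refine ⟨φ.symm z, ⟨(φ.trans g).trans φ.symm, ?_, ?_⟩, φ.apply_symm_apply z⟩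
    · change φ.symm (g (φ x)) = x
      rw [hx]
      exact φ.symm_apply_apply x
    · change φ.symm (g (φ y)) = φ.symm z
      rw [hy]
  · rintro ⟨w, ⟨g, hx, hy⟩, rfl⟩
    refine ⟨(φ.symm.trans g).trans φ, ?_, ?_⟩
    · change φ (g (φ.symm (φ x))) = φ x
      rw [RelIso.symm_apply_apply, hx]
    · change φ (g (φ.symm (φ y))) = φ w
      rw [RelIso.symm_apply_apply, hy]

theorem graphModularCocycle_map {V W : Type} {Γ : SimpleGraph V} {Γ' : SimpleGraph W}
    (φ : Γ ≃g Γ') (x y : V) :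
    graphModularCocycle Γ' (φ x) (φ y) = graphModularCocycle Γ x y := by
  unfold graphModularCocycle
  rw [stabOrbit_map, stabOrbit_map, Set.ncard_image_of_injective _ φ.injective,
    Set.ncard_image_of_injective _ φ.injective]

/-- The modular function: its value at the class of `(Γ, x, y)` is `Δ_Γ(x, y)`. -/
noncomputable def modularFunction : Gr₂ → ℝ≥0∞ :=
  Quotient.lift (fun G : DoublyRootedGraph => graphModularCocycle G.graph G.root G.root₂)
    (by
      rintro G H ⟨φ, h, h'⟩
      rw [← h, ← h', graphModularCocycle_map])

/-- The set of all rootings of graphs whose automorphism group is unimodular. -/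
def unimodularAutSet : Set Gr₁ :=
  {ξ | ∃ (Γ : LFGraph) (x : Γ.V), IsUnimodularGroup (Γ.graph ≃g Γ.graph) ∧ cls₁ Γ x = ξ}

/-- The modular cocycle: the function to which `modularFunction` descends along `sigma`. It is
meaningful only over `unimodularAutSet`, where `modularFunction` is constant on the (nonempty)
fibres of `sigma`; at the other points its value is an arbitrary one of those that
`modularFunction` takes on the fibre. -/
noncomputable def modularCocycle : RelSpace → ℝ≥0∞ :=
  Function.extend sigma modularFunction 1

end RandomGraph

/-!
Write `π` for the map `fstRoot` sending the class of `(Γ, x, y)` to the class of `(Γ, x)`, `J` for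
`rootSwap`, `j` for `relSwap`, `ν` for `fibreVertexCount`, `M` and `M_R` for the counting measures
on doubly rooted graphs and on the equivalence relation, and `m θ = ν_{π θ} {θ}` for the mass of an
atom, so that `m (Γ, x, y) = card (G_x y)` and `modularFunction θ = m θ / m (J θ)`.

Everything rests on the disintegration of `M` over `M_R` along `sigma` (`lintegral_fibreSum`):
`∫ F dM = ∫ S F dM_R`, where `S F p = ∑ F θ * m θ`, the sum being over the countable fibre
`sigma⁻¹ {p}`. Since `J` maps the fibre over `p` onto the fibre over `j p`, one has
`S (F ∘ J) p = ∑ F θ * m (J θ)`, the sum now being over the fibre over `j p`. If the automorphism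
group is unimodular, then the modular function is a constant `Δ p` on the fibre over `p`, and this
reads `S (F ∘ J) p = Δ p * S F (j p)` (`fibreSum_comp_rootSwap`).

* If the three conditions hold, then
  `∫ F ∘ J dM = ∫ Δ * (S F ∘ j) dM_R = ∫ S F ∘ j d(j_* M_R) = ∫ S F dM_R = ∫ F dM`.
* Conversely, let `M` be invariant under `J`. Over the diagonal of the equivalence relation the
  invariance descends to almost every fibre (`IsUnimodular.ae_fibreSum_diag`), which gives
  `m θ = m (J θ)` there, that is, `card (G_x y) = card (G_y x)` for `y` in the orbit `G x`. This is
  equivalent to the unimodularity of the automorphism group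
  (`isUnimodularGroup_of_ncard_stabOrbit_eq`), because `card (G_x y)` is the index of `G_x ∩ G_y`
  in the compact open subgroup `G_x`. Finally, for a weight `W` with `S W = 1` (`fibreWeight`) the
  invariance of `M` gives `j_* M_R = S (W ∘ J) M_R` (`IsUnimodular.map_relSwap_eq`), and
  `S (W ∘ J) p = Δ p * S W (j p) = Δ p`. The weight is needed because the fibres of `sigma` may be
  infinite, so that `sigma_* M` need not be σ-finite.

All measurability questions are reduced to the facts that both spaces of rooted graphs are second
countable and Hausdorff (the latter by a compactness argument, `exists_iso_of_ultrafilter`) and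
that `ν` is an s-finite kernel.
-/

namespace RandomGraph

open Filter Topology ProbabilityTheory

/-! ### Balls and local isomorphisms -/

theorem LFGraph.mem_ball {Γ : LFGraph} {x v : Γ.V} {r : ℕ} :
    v ∈ Γ.ball x r ↔ Γ.graph.dist x v ≤ r := Iff.rfl

theorem LFGraph.root_mem_ball (Γ : LFGraph) (x : Γ.V) (r : ℕ) : x ∈ Γ.ball x r := by
  simp [LFGraph.mem_ball]

theorem LFGraph.ball_finite (Γ : LFGraph) (x : Γ.V) (r : ℕ) : (Γ.ball x r).Finite := by
  induction r with
  | zero =>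
    refine (Set.finite_singleton x).subset fun v hv => ?_
    exact ((Γ.connected.dist_eq_zero_iff).1 (Nat.le_zero.1 hv)).symm
  | succ r ih =>
    refine (ih.union (ih.biUnion fun v _ => Γ.locallyFinite v)).subset fun v hv => ?_
    obtain ⟨w, hw⟩ := Γ.connected.exists_walk_length_eq_dist v x
    rw [Γ.graph.dist_comm] at hw
    cases w with
    | nil => exact Or.inl (Γ.root_mem_ball _ _)
    | cons h w =>
      rename_i u
      refine Or.inr (Set.mem_biUnion (x := u) ?_ h.symm)
      have h1 := SimpleGraph.dist_le w
      simp only [SimpleGraph.Walk.length_cons] at hw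
      rw [LFGraph.mem_ball] at hv ⊢
      rw [Γ.graph.dist_comm]
      omega

theorem LFGraph.countable (Γ : LFGraph) : Countable Γ.V := by
  obtain ⟨x⟩ := Γ.connected.nonempty
  have : (⋃ r, Γ.ball x r) = Set.univ :=
    Set.eq_univ_of_forall fun v => Set.mem_iUnion.2 ⟨Γ.graph.dist x v, LFGraph.mem_ball.2 le_rfl⟩
  rw [← Set.countable_univ_iff, ← this]
  exact Set.countable_iUnion fun r => (Γ.ball_finite x r).countable

/-- The maps `a` and `b` restrict to mutually inverse isomorphisms between the rooted balls of
radius `r` around `x` and around `x'`; their values outside of the balls are irrelevant. -/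
structure LocalIso (Γ Γ' : LFGraph) (r : ℕ) (x : Γ.V) (x' : Γ'.V)
    (a : Γ.V → Γ'.V) (b : Γ'.V → Γ.V) : Prop where
  root : a x = x'
  map : ∀ u ∈ Γ.ball x r, a u ∈ Γ'.ball x' r
  map' : ∀ u ∈ Γ'.ball x' r, b u ∈ Γ.ball x r
  left_inv : ∀ u ∈ Γ.ball x r, b (a u) = u
  right_inv : ∀ u ∈ Γ'.ball x' r, a (b u) = u
  adj : ∀ u ∈ Γ.ball x r, ∀ v ∈ Γ.ball x r, Γ.graph.Adj u v → Γ'.graph.Adj (a u) (a v)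
  adj' : ∀ u ∈ Γ'.ball x' r, ∀ v ∈ Γ'.ball x' r, Γ'.graph.Adj u v → Γ.graph.Adj (b u) (b v)

namespace LocalIso

variable {Γ Γ' : LFGraph} {r s : ℕ} {x y : Γ.V} {x' : Γ'.V} {a : Γ.V → Γ'.V} {b : Γ'.V → Γ.V}

theorem symm (h : LocalIso Γ Γ' r x x' a b) : LocalIso Γ' Γ r x' x b a where
  root := by rw [← h.root, h.left_inv _ (Γ.root_mem_ball x r)]
  map := h.map'
  map' := h.map
  left_inv := h.right_inv
  right_inv := h.left_inv
  adj := h.adj'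
  adj' := h.adj

theorem exists_walk (h : LocalIso Γ Γ' r x x' a b) {u v : Γ.V} (w : Γ.graph.Walk u v)
    (hr : Γ.graph.dist x u + w.length ≤ r) :
    ∃ w' : Γ'.graph.Walk (a u) (a v), w'.length = w.length := by
  induction w with
  | nil => exact ⟨.nil, rfl⟩
  | @cons u u₁ v e w ih =>
    simp only [SimpleGraph.Walk.length_cons] at hr ⊢
    have h1 : Γ.graph.dist x u₁ ≤ Γ.graph.dist x u + 1 :=
      (Γ.connected.dist_triangle (v := u)).trans
        (by rw [SimpleGraph.dist_eq_one_iff_adj.2 e])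
    obtain ⟨w', hw'⟩ := ih (by omega)
    have e' := h.adj u (by rw [LFGraph.mem_ball]; omega) u₁ (by rw [LFGraph.mem_ball]; omega) e
    exact ⟨.cons e' w', by simp [hw']⟩

/-- Local isomorphisms do not increase distances, provided that the ball contains a geodesic. -/
theorem dist_map_le (h : LocalIso Γ Γ' r x x' a b) {u v : Γ.V}
    (hr : Γ.graph.dist x u + Γ.graph.dist u v ≤ r) :
    Γ'.graph.dist (a u) (a v) ≤ Γ.graph.dist u v := by
  obtain ⟨w, hw⟩ := Γ.connected.exists_walk_length_eq_dist u v
  obtain ⟨w', hw'⟩ := h.exists_walk w (by omega)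
  rw [← hw, ← hw']
  exact SimpleGraph.dist_le w'

theorem dist_eq (h : LocalIso Γ Γ' r x x' a b) {u : Γ.V} (hu : u ∈ Γ.ball x r) :
    Γ'.graph.dist x' (a u) = Γ.graph.dist x u := by
  apply le_antisymm
  · have := h.dist_map_le (u := x) (v := u) (by simpa using LFGraph.mem_ball.1 hu)
    rwa [h.root] at this
  · have h' := h.symm
    have := h'.dist_map_le (u := x') (v := a u) (by simpa using LFGraph.mem_ball.1 (h.map u hu))
    rwa [h'.root, h.left_inv u hu] at this

/-- A local isomorphism on a ball restricts to the smaller balls inside it, around any centre. -/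
theorem recentre (h : LocalIso Γ Γ' r x x' a b) (hs : Γ.graph.dist x y + s ≤ r) :
    LocalIso Γ Γ' s y (a y) a b := by
  have hy : y ∈ Γ.ball x r := by rw [LFGraph.mem_ball]; omega
  have hsub : ∀ u ∈ Γ.ball y s, u ∈ Γ.ball x r := fun u hu => by
    have := Γ.connected.dist_triangle (u := x) (v := y) (w := u)
    rw [LFGraph.mem_ball] at hu ⊢
    omega
  have hsub' : ∀ u ∈ Γ'.ball (a y) s, u ∈ Γ'.ball x' r := fun u hu => by
    have := Γ'.connected.dist_triangle (u := x') (v := a y) (w := u)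
    have := h.dist_eq hy
    rw [LFGraph.mem_ball] at hu ⊢
    omega
  refine ⟨rfl, fun u hu => ?_, fun u hu => ?_, fun u hu => h.left_inv u (hsub u hu),
    fun u hu => h.right_inv u (hsub' u hu),
    fun u hu v hv => h.adj u (hsub u hu) v (hsub v hv),
    fun u hu v hv => h.adj' u (hsub' u hu) v (hsub' v hv)⟩
  · rw [LFGraph.mem_ball] at hu
    exact (h.dist_map_le (u := y) (v := u) (by omega)).trans hu
  · rw [LFGraph.mem_ball] at hu
    have := h.symm.dist_map_le (u := a y) (v := u) (by rw [h.dist_eq hy]; omega)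
    rw [h.left_inv y hy] at this
    exact this.trans hu

theorem mono (h : LocalIso Γ Γ' r x x' a b) (hs : s ≤ r) : LocalIso Γ Γ' s x x' a b := by
  have := h.recentre (y := x) (s := s) (by simpa using hs)
  rwa [h.root] at this

theorem ofIso (φ : Γ.graph ≃g Γ'.graph) (x : Γ.V) (r : ℕ) :
    LocalIso Γ Γ' r x (φ x) φ φ.symm := by
  have key : ∀ {Γ Γ' : LFGraph} (φ : Γ.graph ≃g Γ'.graph) (u v : Γ.V),
      Γ'.graph.dist (φ u) (φ v) ≤ Γ.graph.dist u v := by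
    intro Γ Γ' φ u v
    obtain ⟨w, hw⟩ := Γ.connected.exists_walk_length_eq_dist u v
    rw [← hw]
    exact (SimpleGraph.dist_le (w.map φ.toHom)).trans (by simp)
  refine ⟨rfl, fun u hu => (key φ x u).trans hu, fun u hu => ?_, fun u _ => φ.symm_apply_apply u,
    fun u _ => φ.apply_symm_apply u, fun u _ v _ h => φ.map_rel_iff.2 h,
    fun u _ v _ h => φ.symm.map_rel_iff.2 h⟩
  have := key φ.symm (φ x) u
  rw [φ.symm_apply_apply] at this
  exact this.trans hu

end LocalIso

theorem dist_map {Γ Γ' : LFGraph} (φ : Γ.graph ≃g Γ'.graph) (u v : Γ.V) :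
    Γ'.graph.dist (φ u) (φ v) = Γ.graph.dist u v :=
  (LocalIso.ofIso φ u (Γ.graph.dist u v)).dist_eq (LFGraph.mem_ball.2 le_rfl)

/-- The extension of an isomorphism of rooted balls to total maps. -/
theorem exists_localIso {r : ℕ} {G H : RootedGraph}
    (φ : G.graph.induce (G.ball G.root r) ≃g H.graph.induce (H.ball H.root r))
    (hφ : ∀ u : G.ball G.root r, (u : G.V) = G.root ↔ (φ u : H.V) = H.root) :
    ∃ a b, LocalIso G.toLFGraph H.toLFGraph r G.root H.root a b ∧
      ∀ u : G.ball G.root r, a u = φ u := by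
  classical
  refine ⟨fun u => if h : u ∈ G.ball G.root r then φ ⟨u, h⟩ else H.root,
    fun u => if h : u ∈ H.ball H.root r then φ.symm ⟨u, h⟩ else G.root, ?_, ?_⟩
  · refine ⟨?_, ?_, ?_, ?_, ?_, ?_, ?_⟩
    · have h := G.root_mem_ball G.root r
      simpa [h] using (hφ ⟨G.root, h⟩).1 rfl
    · intro u hu
      simp only [hu, dite_true]
      exact (φ ⟨u, hu⟩).2
    · intro u hu
      simp only [hu, dite_true]
      exact (φ.symm ⟨u, hu⟩).2
    · intro u hu
      simp [hu]
    · intro u hu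
      simp [hu]
    · intro u hu v hv h
      simp only [hu, hv, dite_true]
      exact (φ.map_adj_iff (v := ⟨u, hu⟩) (w := ⟨v, hv⟩)).2 h
    · intro u hu v hv h
      simp only [hu, hv, dite_true]
      exact (φ.symm.map_adj_iff (v := ⟨u, hu⟩) (w := ⟨v, hv⟩)).2 h
  · rintro ⟨u, hu⟩
    simp only [hu, dite_true]

theorem LocalIso.exists_iso {r : ℕ} {Γ Γ' : LFGraph} {x : Γ.V} {x' : Γ'.V} {a b}
    (h : LocalIso Γ Γ' r x x' a b) :
    ∃ φ : Γ.graph.induce (Γ.ball x r) ≃g Γ'.graph.induce (Γ'.ball x' r),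
      (∀ u, (φ u : Γ'.V) = a u) ∧ ∀ u : Γ.ball x r, (u : Γ.V) = x ↔ (φ u : Γ'.V) = x' := by
  refine ⟨⟨⟨fun u => ⟨a u, h.map u u.2⟩, fun u => ⟨b u, h.map' u u.2⟩,
    fun u => Subtype.ext (h.left_inv u u.2), fun u => Subtype.ext (h.right_inv u u.2)⟩, ?_⟩,
    fun u => rfl, ?_⟩
  · rintro ⟨u, hu⟩ ⟨v, hv⟩
    refine ⟨fun e => ?_, h.adj u hu v hv⟩
    have := h.adj' _ (h.map u hu) _ (h.map v hv) e
    rwa [h.left_inv u hu, h.left_inv v hv] at this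
  · rintro ⟨u, hu⟩
    change u = x ↔ a u = x'
    refine ⟨fun e => by rw [e, h.root], fun e => ?_⟩
    rw [← h.left_inv u hu, e, h.symm.root]

theorem ballIso₁_iff {r : ℕ} {G H : RootedGraph} :
    BallIso₁ r G H ↔ ∃ a b, LocalIso G.toLFGraph H.toLFGraph r G.root H.root a b := by
  constructor
  · rintro ⟨φ, hφ⟩
    obtain ⟨a, b, h, -⟩ := exists_localIso φ hφ
    exact ⟨a, b, h⟩
  · rintro ⟨a, b, h⟩
    obtain ⟨φ, -, hφ⟩ := h.exists_iso
    exact ⟨φ, hφ⟩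

theorem ballIso₂_iff {r : ℕ} {G H : DoublyRootedGraph} :
    BallIso₂ r G H ↔ ∃ a b, LocalIso G.toLFGraph H.toLFGraph r G.root H.root a b ∧
      ∀ u ∈ G.ball G.root r, u = G.root₂ ↔ a u = H.root₂ := by
  constructor
  · rintro ⟨φ, hφ, hφ'⟩
    obtain ⟨a, b, h, h'⟩ := exists_localIso (G := ⟨G.toLFGraph, G.root⟩)
      (H := ⟨H.toLFGraph, H.root⟩) φ hφ
    exact ⟨a, b, h, fun u hu => by rw [h' ⟨u, hu⟩]; exact hφ' ⟨u, hu⟩⟩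
  · rintro ⟨a, b, h, h'⟩
    obtain ⟨φ, e, hφ⟩ := h.exists_iso
    exact ⟨φ, hφ, fun u => by rw [e]; exact h' u u.2⟩

theorem BallIso₁.trans {r : ℕ} {G H K : RootedGraph} (h : BallIso₁ r G H) (k : BallIso₁ r H K) :
    BallIso₁ r G K := by
  obtain ⟨φ, h⟩ := h
  obtain ⟨ψ, k⟩ := k
  exact ⟨φ.trans ψ, fun u => (h u).trans (k (φ u))⟩

theorem BallIso₂.symm {r : ℕ} {G H : DoublyRootedGraph} (h : BallIso₂ r G H) :
    BallIso₂ r H G := by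
  obtain ⟨φ, h, h'⟩ := h
  exact ⟨φ.symm, fun u => by simpa using (h (φ.symm u)).symm,
    fun u => by simpa using (h' (φ.symm u)).symm⟩

theorem BallIso₂.trans {r : ℕ} {G H K : DoublyRootedGraph} (h : BallIso₂ r G H)
    (k : BallIso₂ r H K) : BallIso₂ r G K := by
  obtain ⟨φ, h, h'⟩ := h
  obtain ⟨ψ, k, k'⟩ := k
  exact ⟨φ.trans ψ, fun u => (h u).trans (k (φ u)), fun u => (h' u).trans (k' (φ u))⟩

theorem BallIso₁.of_equiv {G H : RootedGraph} (h : G ≈ H) (r : ℕ) : BallIso₁ r G H := by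
  obtain ⟨φ, h⟩ := h
  exact ballIso₁_iff.2 ⟨φ, φ.symm, h ▸ LocalIso.ofIso φ G.root r⟩

theorem BallIso₂.of_equiv {G H : DoublyRootedGraph} (h : G ≈ H) (r : ℕ) : BallIso₂ r G H := by
  obtain ⟨φ, h, h'⟩ := h
  exact ballIso₂_iff.2 ⟨φ, φ.symm, h ▸ LocalIso.ofIso φ G.root r,
    fun u _ => by rw [← h']; exact φ.injective.eq_iff.symm⟩

theorem BallIso₂.mono {r s : ℕ} {G H : DoublyRootedGraph} (h : BallIso₂ r G H) (hs : s ≤ r) :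
    BallIso₂ s G H := by
  obtain ⟨a, b, h, h'⟩ := ballIso₂_iff.1 h
  exact ballIso₂_iff.2 ⟨a, b, h.mono hs, fun u hu => h' u (le_trans hu hs)⟩

theorem BallIso₂.fst {r : ℕ} {G H : DoublyRootedGraph} (h : BallIso₂ r G H) :
    BallIso₁ r ⟨G.toLFGraph, G.root⟩ ⟨H.toLFGraph, H.root⟩ :=
  let ⟨φ, h, _⟩ := h
  ⟨φ, h⟩

theorem BallIso₂.dist_eq {r : ℕ} {G H : DoublyRootedGraph} (h : BallIso₂ r G H)
    (hr : G.graph.dist G.root G.root₂ ≤ r) :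
    H.graph.dist H.root H.root₂ = G.graph.dist G.root G.root₂ := by
  obtain ⟨a, b, h, h'⟩ := ballIso₂_iff.1 h
  rw [← (h' G.root₂ hr).1 rfl]
  exact h.dist_eq hr

/-- The ball of radius `s` around the secondary root is determined by a ball around the primary
root that contains it. -/
theorem BallIso₂.swap {r s : ℕ} {G H : DoublyRootedGraph} (h : BallIso₂ r G H)
    (hr : G.graph.dist G.root G.root₂ + s ≤ r) (hs : G.graph.dist G.root G.root₂ ≤ s) :
    BallIso₂ s ⟨G.toLFGraph, G.root₂, G.root⟩ ⟨H.toLFGraph, H.root₂, H.root⟩ := by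
  obtain ⟨a, b, h, h'⟩ := ballIso₂_iff.1 h
  have e : a G.root₂ = H.root₂ := (h' G.root₂ (by rw [LFGraph.mem_ball]; omega)).1 rfl
  have k := h.recentre hr
  rw [e] at k
  refine ballIso₂_iff.2 ⟨a, b, k, fun u hu => ?_⟩
  change u = G.root ↔ a u = H.root
  have hx : G.root ∈ G.ball G.root₂ s := by rw [LFGraph.mem_ball, SimpleGraph.dist_comm]; exact hs
  rw [← h.root]
  exact ⟨fun e => by rw [e], fun e => by rw [← k.left_inv u hu, e, k.left_inv _ hx]⟩

/-! ### Limits of local isomorphisms -/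

/-- Along an ultrafilter, maps that are asymptotically mutually inverse isomorphisms and have
finitely many values at each vertex converge pointwise to an isomorphism. -/
theorem exists_iso_of_ultrafilter {ι V W : Type} (f : Ultrafilter ι) {Γ : SimpleGraph V}
    {Γ' : SimpleGraph W} (a : ι → V → W) (b : ι → W → V)
    (hfa : ∀ v, ∃ T : Set W, T.Finite ∧ ∀ᶠ i in (f : Filter ι), a i v ∈ T)
    (hfb : ∀ w, ∃ T : Set V, T.Finite ∧ ∀ᶠ i in (f : Filter ι), b i w ∈ T)
    (hba : ∀ v, ∀ᶠ i in (f : Filter ι), b i (a i v) = v)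
    (hab : ∀ w, ∀ᶠ i in (f : Filter ι), a i (b i w) = w)
    (hadj : ∀ u v, ∀ᶠ i in (f : Filter ι), Γ.Adj u v ↔ Γ'.Adj (a i u) (a i v)) :
    ∃ φ : Γ ≃g Γ', ∀ v, ∀ᶠ i in (f : Filter ι), a i v = φ v := by
  have key : ∀ {A B : Type} (c : ι → A → B),
      (∀ v, ∃ T : Set B, T.Finite ∧ ∀ᶠ i in (f : Filter ι), c i v ∈ T) →
      ∀ v, ∃ w, ∀ᶠ i in (f : Filter ι), c i v = w := by
    intro A B c hc v
    obtain ⟨T, hT, h⟩ := hc v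
    have h' : (⋃ w ∈ T, {i | c i v = w}) ∈ f := by
      filter_upwards [h] with i hi
      exact Set.mem_biUnion hi rfl
    obtain ⟨w, -, hw⟩ := (Ultrafilter.finite_biUnion_mem_iff hT).1 h'
    exact ⟨w, hw⟩
  choose A hA using key a hfa
  choose B hB using key b hfb
  have h1 : ∀ v, B (A v) = v := fun v => by
    obtain ⟨i, h, h', h''⟩ := ((hA v).and ((hB (A v)).and (hba v))).exists
    rw [← h', ← h, h'']
  have h2 : ∀ w, A (B w) = w := fun w => by
    obtain ⟨i, h, h', h''⟩ := ((hB w).and ((hA (B w)).and (hab w))).exists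
    rw [← h', ← h, h'']
  refine ⟨⟨⟨A, B, h1, h2⟩, fun {u v} => ?_⟩, hA⟩
  obtain ⟨i, h, h', h''⟩ := ((hA u).and ((hA v).and (hadj u v))).exists
  change Γ'.Adj (A u) (A v) ↔ Γ.Adj u v
  rw [h'', h, h']

/-- Doubly rooted graphs with isomorphic balls of all radii are isomorphic. -/
theorem equiv_of_forall_ballIso₂ {G H : DoublyRootedGraph} (h : ∀ r, BallIso₂ r G H) : G ≈ H := by
  choose a b hab h2 using fun r => ballIso₂_iff.1 (h r)
  -- Distances from the root are preserved, so every vertex has only finitely many images, and the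
  -- isomorphisms of balls have a limit along a nonprincipal ultrafilter.
  let f : Ultrafilter ℕ := Ultrafilter.of atTop
  have hf : (f : Filter ℕ) ≤ atTop := Ultrafilter.of_le _
  have hG : ∀ v : G.V, ∀ᶠ r in (f : Filter ℕ), v ∈ G.ball G.root r := fun v =>
    hf (eventually_ge_atTop (G.graph.dist G.root v))
  have hH : ∀ v : H.V, ∀ᶠ r in (f : Filter ℕ), v ∈ H.ball H.root r := fun v =>
    hf (eventually_ge_atTop (H.graph.dist H.root v))
  obtain ⟨φ, hφ⟩ := exists_iso_of_ultrafilter f (Γ := G.graph) (Γ' := H.graph) a b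
    (fun v => ⟨_, H.ball_finite H.root (G.graph.dist G.root v), by
      filter_upwards [hG v] with r hr
      exact ((hab r).dist_eq hr).le⟩)
    (fun v => ⟨_, G.ball_finite G.root (H.graph.dist H.root v), by
      filter_upwards [hH v] with r hr
      exact ((hab r).symm.dist_eq hr).le⟩)
    (fun v => by filter_upwards [hG v] with r hr using (hab r).left_inv v hr)
    (fun v => by filter_upwards [hH v] with r hr using (hab r).right_inv v hr)
    (fun u v => by
      filter_upwards [hG u, hG v] with r hu hv
      refine ⟨(hab r).adj u hu v hv, fun e => ?_⟩
      have := (hab r).adj' _ ((hab r).map u hu) _ ((hab r).map v hv) e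
      rwa [(hab r).left_inv u hu, (hab r).left_inv v hv] at this)
  refine ⟨φ, ?_, ?_⟩
  · obtain ⟨r, hr⟩ := (hφ G.root).exists
    rw [← hr, (hab r).root]
  · obtain ⟨r, hr, hr'⟩ := ((hφ G.root₂).and (hG G.root₂)).exists
    rw [← hr, (h2 r _ hr').1 rfl]

/-! ### The topology of the spaces of rooted graphs -/

theorem cls₁_surjective (ξ : Gr₁) : ∃ (Γ : LFGraph) (x : Γ.V), cls₁ Γ x = ξ :=
  Quotient.inductionOn ξ fun G => ⟨G.toLFGraph, G.root, rfl⟩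

theorem cls₂_surjective (θ : Gr₂) : ∃ (Γ : LFGraph) (x y : Γ.V), cls₂ Γ x y = θ :=
  Quotient.inductionOn θ fun G => ⟨G.toLFGraph, G.root, G.root₂, rfl⟩

theorem cls₁_eq_iff {Γ Γ' : LFGraph} {x : Γ.V} {x' : Γ'.V} :
    cls₁ Γ x = cls₁ Γ' x' ↔ ∃ φ : Γ.graph ≃g Γ'.graph, φ x = x' :=
  Quotient.eq (r := RootedGraph.setoid)

theorem cls₂_eq_iff {Γ Γ' : LFGraph} {x y : Γ.V} {x' y' : Γ'.V} :
    cls₂ Γ x y = cls₂ Γ' x' y' ↔ ∃ φ : Γ.graph ≃g Γ'.graph, φ x = x' ∧ φ y = y' :=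
  Quotient.eq (r := DoublyRootedGraph.setoid)

/-- The basic open sets of `Gr₁`. -/
def cylinder₁ (G : RootedGraph) (r : ℕ) : Set Gr₁ :=
  {ξ | ∃ H : RootedGraph, BallIso₁ r G H ∧ cls₁ H.toLFGraph H.root = ξ}

/-- The basic open sets of `Gr₂`. -/
def cylinder₂ (G : DoublyRootedGraph) (r : ℕ) : Set Gr₂ :=
  {θ | ∃ H : DoublyRootedGraph, BallIso₂ r G H ∧ cls₂ H.toLFGraph H.root H.root₂ = θ}

theorem cls₁_mem_cylinder₁ {G : RootedGraph} {r : ℕ} {Γ : LFGraph} {x : Γ.V} :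
    cls₁ Γ x ∈ cylinder₁ G r ↔ BallIso₁ r G ⟨Γ, x⟩ := by
  refine ⟨?_, fun h => ⟨⟨Γ, x⟩, h, rfl⟩⟩
  rintro ⟨H, h, e⟩
  exact h.trans (BallIso₁.of_equiv (G := H) (H := ⟨Γ, x⟩) (cls₁_eq_iff.1 e) r)

theorem cls₂_mem_cylinder₂ {G : DoublyRootedGraph} {r : ℕ} {Γ : LFGraph} {x y : Γ.V} :
    cls₂ Γ x y ∈ cylinder₂ G r ↔ BallIso₂ r G ⟨Γ, x, y⟩ := by
  refine ⟨?_, fun h => ⟨⟨Γ, x, y⟩, h, rfl⟩⟩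
  rintro ⟨H, h, e⟩
  exact h.trans (BallIso₂.of_equiv (G := H) (H := ⟨Γ, x, y⟩) (cls₂_eq_iff.1 e) r)

theorem BallIso₁.refl (r : ℕ) (G : RootedGraph) : BallIso₁ r G G :=
  BallIso₁.of_equiv (Setoid.refl G) r

theorem BallIso₂.refl (r : ℕ) (G : DoublyRootedGraph) : BallIso₂ r G G :=
  BallIso₂.of_equiv (Setoid.refl G) r

theorem isOpen_cylinder₁ (G : RootedGraph) (r : ℕ) : IsOpen (cylinder₁ G r) :=
  TopologicalSpace.isOpen_generateFrom_of_mem ⟨G, r, rfl⟩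

theorem isOpen_cylinder₂ (G : DoublyRootedGraph) (r : ℕ) : IsOpen (cylinder₂ G r) :=
  TopologicalSpace.isOpen_generateFrom_of_mem ⟨G, r, rfl⟩

theorem isOpen_of_ballIso₁ {A : Set Gr₁}
    (h : ∀ (Γ : LFGraph) (x : Γ.V), cls₁ Γ x ∈ A → ∃ r, ∀ (Γ' : LFGraph) (x' : Γ'.V),
      BallIso₁ r ⟨Γ, x⟩ ⟨Γ', x'⟩ → cls₁ Γ' x' ∈ A) : IsOpen A := by
  refine isOpen_iff_forall_mem_open.2 fun ξ hξ => ?_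
  obtain ⟨Γ, x, rfl⟩ := cls₁_surjective ξ
  obtain ⟨r, hr⟩ := h Γ x hξ
  refine ⟨cylinder₁ ⟨Γ, x⟩ r, ?_, isOpen_cylinder₁ _ _, cls₁_mem_cylinder₁.2 (.refl _ _)⟩
  rintro _ ⟨H, hH, rfl⟩
  exact hr _ _ hH

theorem isOpen_of_ballIso₂ {A : Set Gr₂}
    (h : ∀ (Γ : LFGraph) (x y : Γ.V), cls₂ Γ x y ∈ A → ∃ r, ∀ (Γ' : LFGraph) (x' y' : Γ'.V),
      BallIso₂ r ⟨Γ, x, y⟩ ⟨Γ', x', y'⟩ → cls₂ Γ' x' y' ∈ A) : IsOpen A := by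
  refine isOpen_iff_forall_mem_open.2 fun θ hθ => ?_
  obtain ⟨Γ, x, y, rfl⟩ := cls₂_surjective θ
  obtain ⟨r, hr⟩ := h Γ x y hθ
  refine ⟨cylinder₂ ⟨Γ, x, y⟩ r, ?_, isOpen_cylinder₂ _ _, cls₂_mem_cylinder₂.2 (.refl _ _)⟩
  rintro _ ⟨H, hH, rfl⟩
  exact hr _ _ _ hH

/-- The map sending the class of `(Γ, x, y)` to the class of `(Γ, x)`. -/
def fstRoot (θ : Gr₂) : Gr₁ := (sigma θ).1.1

/-- The map sending the class of `(Γ, x, y)` to the class of `(Γ, y)`. -/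
def sndRoot (θ : Gr₂) : Gr₁ := (sigma θ).1.2

/-- The map sending the class of `(Γ, x)` to the class of `(Γ, x, x)`. -/
def diagRoot : Gr₁ → Gr₂ :=
  Quotient.lift (fun G : RootedGraph => cls₂ G.toLFGraph G.root G.root)
    (fun _ _ ⟨φ, h⟩ => Quotient.sound ⟨φ, h, h⟩)

/-- The distance between the two roots. -/
noncomputable def rootDist : Gr₂ → ℕ :=
  Quotient.lift (fun G : DoublyRootedGraph => G.graph.dist G.root G.root₂)
    (by
      rintro G H ⟨φ, h, h'⟩
      rw [← h, ← h', dist_map φ])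

@[simp] theorem fstRoot_cls₂ (Γ : LFGraph) (x y : Γ.V) : fstRoot (cls₂ Γ x y) = cls₁ Γ x := rfl

@[simp] theorem rootSwap_cls₂ (Γ : LFGraph) (x y : Γ.V) :
    rootSwap (cls₂ Γ x y) = cls₂ Γ y x := rfl

@[simp] theorem rootDist_cls₂ (Γ : LFGraph) (x y : Γ.V) :
    rootDist (cls₂ Γ x y) = Γ.graph.dist x y := rfl

@[simp] theorem rootSwap_rootSwap (θ : Gr₂) : rootSwap (rootSwap θ) = θ := by
  obtain ⟨Γ, x, y, rfl⟩ := cls₂_surjective θ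
  rfl

@[simp] theorem fstRoot_rootSwap (θ : Gr₂) : fstRoot (rootSwap θ) = sndRoot θ := by
  obtain ⟨Γ, x, y, rfl⟩ := cls₂_surjective θ
  rfl

@[simp] theorem sndRoot_rootSwap (θ : Gr₂) : sndRoot (rootSwap θ) = fstRoot θ := by
  obtain ⟨Γ, x, y, rfl⟩ := cls₂_surjective θ
  rfl

theorem continuous_fstRoot : Continuous fstRoot := by
  refine continuous_generateFrom_iff.2 ?_
  rintro _ ⟨G, r, rfl⟩
  refine isOpen_of_ballIso₂ fun Γ x y h => ⟨r, fun Γ' x' y' h' => ?_⟩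
  exact cls₁_mem_cylinder₁.2 ((cls₁_mem_cylinder₁.1 h).trans h'.fst)

theorem continuous_rootSwap : Continuous rootSwap := by
  refine continuous_generateFrom_iff.2 ?_
  rintro _ ⟨G, r, rfl⟩
  refine isOpen_of_ballIso₂ fun Γ x y h =>
    ⟨Γ.graph.dist x y + max (Γ.graph.dist x y) r, fun Γ' x' y' h' => ?_⟩
  have := (h'.swap le_rfl (le_max_left _ _)).mono (le_max_right _ r)
  exact cls₂_mem_cylinder₂.2 ((cls₂_mem_cylinder₂.1 h).trans this)

theorem continuous_sndRoot : Continuous sndRoot := by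
  have : sndRoot = fstRoot ∘ rootSwap := funext fun θ => (fstRoot_rootSwap θ).symm
  rw [this]
  exact continuous_fstRoot.comp continuous_rootSwap

theorem continuous_rootDist : Continuous rootDist := by
  refine continuous_discrete_rng.2 fun n => isOpen_of_ballIso₂ fun Γ x y h =>
    ⟨Γ.graph.dist x y, fun Γ' x' y' h' => ?_⟩
  exact (h'.dist_eq le_rfl).trans h

instance : T2Space Gr₂ := by
  refine ⟨fun θ θ' hne => ?_⟩
  obtain ⟨Γ, x, y, rfl⟩ := cls₂_surjective θ
  obtain ⟨Γ', x', y', rfl⟩ := cls₂_surjective θ'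
  obtain ⟨r, hr⟩ : ∃ r, ¬ BallIso₂ r ⟨Γ, x, y⟩ ⟨Γ', x', y'⟩ := by
    by_contra! h
    exact hne (cls₂_eq_iff.2 (equiv_of_forall_ballIso₂ h))
  refine ⟨_, _, isOpen_cylinder₂ ⟨Γ, x, y⟩ r, isOpen_cylinder₂ ⟨Γ', x', y'⟩ r,
    cls₂_mem_cylinder₂.2 (.refl _ _), cls₂_mem_cylinder₂.2 (.refl _ _), ?_⟩
  refine Set.disjoint_left.2 fun θ h h' => hr ?_
  obtain ⟨Γ₁, x₁, y₁, rfl⟩ := cls₂_surjective θ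
  exact (cls₂_mem_cylinder₂.1 h).trans (cls₂_mem_cylinder₂.1 h').symm

/-- There are only countably many cylinders, since a ball is isomorphic to a graph on `Fin n` with
two distinguished sets of vertices (the second one being empty if the secondary root lies outside
of the ball). -/
theorem countable_cylinder₂ :
    {U : Set Gr₂ | ∃ (G : DoublyRootedGraph) (r : ℕ), U = cylinder₂ G r}.Countable := by
  let C : ℕ × (Σ n : ℕ, Set (Fin n × Fin n) × Set (Fin n) × Set (Fin n)) → Set Gr₂ := fun c =>
    {θ | ∃ (H : DoublyRootedGraph) (e : H.ball H.root c.1 ≃ Fin c.2.1),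
      cls₂ H.toLFGraph H.root H.root₂ = θ ∧
      (∀ u v : H.ball H.root c.1, H.graph.Adj u v ↔ (e u, e v) ∈ c.2.2.1) ∧
      (∀ u : H.ball H.root c.1, (u : H.V) = H.root ↔ e u ∈ c.2.2.2.1) ∧
      (∀ u : H.ball H.root c.1, (u : H.V) = H.root₂ ↔ e u ∈ c.2.2.2.2)}
  refine (Set.countable_range C).mono ?_
  rintro _ ⟨G, r, rfl⟩
  have := (G.ball_finite G.root r).to_subtype
  obtain ⟨n, ⟨e⟩⟩ := Finite.exists_equiv_fin (G.ball G.root r)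
  refine ⟨⟨r, n, {p | G.graph.Adj (e.symm p.1) (e.symm p.2)}, {p | (e.symm p : G.V) = G.root},
    {p | (e.symm p : G.V) = G.root₂}⟩, Set.ext fun θ => ⟨?_, ?_⟩⟩
  · rintro ⟨H, e', rfl, h1, h2, h3⟩
    refine ⟨H, ⟨⟨e.trans e'.symm, fun {u v} => ?_⟩, fun u => ?_, fun u => ?_⟩, rfl⟩
    · change H.graph.Adj (e'.symm (e u)) (e'.symm (e v)) ↔ G.graph.Adj u v
      simp [h1]
    · change _ ↔ (e'.symm (e u) : H.V) = H.root
      simp [h2]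
    · change _ ↔ (e'.symm (e u) : H.V) = H.root₂
      simp [h3]
  · rintro ⟨H, ⟨φ, h2, h3⟩, rfl⟩
    refine ⟨H, φ.symm.toEquiv.trans e, rfl, fun u v => ?_, fun u => ?_, fun u => ?_⟩
    · change _ ↔ G.graph.Adj (e.symm (e (φ.symm u))) (e.symm (e (φ.symm v)))
      rw [e.symm_apply_apply, e.symm_apply_apply]
      exact (φ.symm.map_adj_iff (v := u) (w := v)).symm
    · change _ ↔ (e.symm (e (φ.symm u)) : G.V) = G.root
      rw [e.symm_apply_apply, h2, φ.apply_symm_apply]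
    · change _ ↔ (e.symm (e (φ.symm u)) : G.V) = G.root₂
      rw [e.symm_apply_apply, h3, φ.apply_symm_apply]

instance : SecondCountableTopology Gr₂ := ⟨⟨_, countable_cylinder₂, rfl⟩⟩

theorem ballIso₂_diag {r : ℕ} {Γ Γ' : LFGraph} {x : Γ.V} {x' : Γ'.V} :
    BallIso₂ r ⟨Γ, x, x⟩ ⟨Γ', x', x'⟩ ↔ BallIso₁ r ⟨Γ, x⟩ ⟨Γ', x'⟩ :=
  ⟨fun h => h.fst, fun ⟨φ, h⟩ => ⟨φ, h, h⟩⟩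

/-- The space of rooted graphs embeds into the space of doubly rooted graphs. -/
theorem isInducing_diagRoot : IsInducing diagRoot := by
  refine ⟨le_antisymm ?_ ?_⟩
  · refine continuous_iff_le_induced.1 (continuous_generateFrom_iff.2 ?_)
    rintro _ ⟨G, r, rfl⟩
    refine isOpen_of_ballIso₁ fun Γ x h => ⟨r, fun Γ' x' h' => ?_⟩
    exact cls₂_mem_cylinder₂.2 ((cls₂_mem_cylinder₂.1 h).trans (ballIso₂_diag.2 h'))
  · refine le_generateFrom ?_
    rintro _ ⟨G, r, rfl⟩
    refine ⟨cylinder₂ ⟨G.toLFGraph, G.root, G.root⟩ r, isOpen_cylinder₂ _ _, ?_⟩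
    refine Set.ext fun ξ => ?_
    obtain ⟨Γ, x, rfl⟩ := cls₁_surjective ξ
    exact cls₂_mem_cylinder₂.trans (ballIso₂_diag.trans cls₁_mem_cylinder₁.symm)

theorem fstRoot_diagRoot (ξ : Gr₁) : fstRoot (diagRoot ξ) = ξ := by
  obtain ⟨Γ, x, rfl⟩ := cls₁_surjective ξ
  rfl

instance : T2Space Gr₁ :=
  T2Space.of_injective_continuous (Function.LeftInverse.injective fstRoot_diagRoot)
    isInducing_diagRoot.continuous

instance : SecondCountableTopology Gr₁ := isInducing_diagRoot.secondCountableTopology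

theorem measurable_fstRoot : Measurable fstRoot := continuous_fstRoot.measurable

theorem measurable_sndRoot : Measurable sndRoot := continuous_sndRoot.measurable

theorem measurable_rootSwap : Measurable rootSwap := continuous_rootSwap.measurable

theorem measurable_rootDist : Measurable rootDist := continuous_rootDist.measurable

theorem measurable_sigma : Measurable sigma :=
  (measurable_fstRoot.prodMk measurable_sndRoot).subtype_mk

theorem measurable_relSwap : Measurable relSwap :=
  (measurable_swap.comp measurable_subtype_coe).subtype_mk

/-! ### The automorphism group as a topological group -/

section Aut

variable {V : Type} {Γ : SimpleGraph V}

theorem tendsto_aut_iff {ι : Type*} {f : ι → Γ ≃g Γ} {l : Filter ι} {g : Γ ≃g Γ} :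
    Tendsto f l (𝓝 g) ↔ ∀ v, ∀ᶠ i in l, f i v = g v := by
  let _ : TopologicalSpace V := ⊥
  have _ : DiscreteTopology V := ⟨rfl⟩
  have hind : IsInducing (fun (g : Γ ≃g Γ) (v : V) => g v) := ⟨rfl⟩
  rw [hind.tendsto_nhds_iff, tendsto_pi_nhds]
  simp only [nhds_discrete, tendsto_pure, Function.comp_apply]

instance : IsTopologicalGroup (Γ ≃g Γ) where
  continuous_mul := by
    refine continuous_iff_continuousAt.2 fun p => tendsto_aut_iff.2 fun v => ?_
    have h1 := tendsto_aut_iff.1 (continuous_snd.tendsto p) v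
    have h2 := tendsto_aut_iff.1 (continuous_fst.tendsto p) (p.2 v)
    filter_upwards [h1, h2] with q hq hq'
    change q.1 (q.2 v) = p.1 (p.2 v)
    rw [hq, hq']
  continuous_inv := by
    refine continuous_iff_continuousAt.2 fun g => tendsto_aut_iff.2 fun v => ?_
    filter_upwards [tendsto_aut_iff.1 (continuous_id.tendsto g) (g.symm v)] with h hh
    change h.symm v = g.symm v
    rw [RelIso.symm_apply_eq]
    exact (g.apply_symm_apply v).symm.trans hh.symm

theorem secondCountableTopology_aut [Countable V] : SecondCountableTopology (Γ ≃g Γ) := by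
  let _ : TopologicalSpace V := ⊥
  have _ : DiscreteTopology V := ⟨rfl⟩
  have hind : IsInducing (fun (g : Γ ≃g Γ) (v : V) => g v) := ⟨rfl⟩
  exact hind.secondCountableTopology

/-- The set of automorphisms that move `x` to `y`. -/
def transporter (Γ : SimpleGraph V) (x y : V) : Set (Γ ≃g Γ) := {g | g x = y}

theorem isOpen_transporter (x y : V) : IsOpen (transporter Γ x y) := by
  refine isOpen_iff_mem_nhds.2 fun g hg => ?_
  filter_upwards [tendsto_aut_iff.1 (continuous_id.tendsto g) x] with h hh
  exact hh.trans hg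

end Aut

variable {Γ : LFGraph}

/-- An automorphism moving `x` to `y` maps spheres around `x` to spheres around `y`, which are
finite; hence every ultrafilter of such automorphisms converges. -/
theorem isCompact_transporter (x y : Γ.V) : IsCompact (transporter Γ.graph x y) := by
  refine isCompact_iff_ultrafilter_le_nhds.2 fun f hf => ?_
  have hf' : ∀ᶠ g in (f : Filter (Γ.graph ≃g Γ.graph)), g x = y := le_principal_iff.1 hf
  obtain ⟨φ, hφ⟩ := exists_iso_of_ultrafilter f (Γ := Γ.graph) (Γ' := Γ.graph)
    (fun g => g) (fun g => g.symm)
    (fun v => ⟨_, Γ.ball_finite y (Γ.graph.dist x v), by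
      filter_upwards [hf'] with g hg
      rw [LFGraph.mem_ball, ← hg, dist_map g]⟩)
    (fun v => ⟨_, Γ.ball_finite x (Γ.graph.dist y v), by
      filter_upwards [hf'] with g hg
      rw [LFGraph.mem_ball, ← dist_map g, hg, g.apply_symm_apply]⟩)
    (fun v => .of_forall fun g => g.symm_apply_apply v)
    (fun v => .of_forall fun g => g.apply_symm_apply v)
    (fun u v => .of_forall fun g => g.map_adj_iff.symm)
  refine ⟨φ, ?_, ?_⟩
  · obtain ⟨g, hg, hg'⟩ := ((hφ x).and hf').exists
    exact hg.symm.trans hg'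
  · exact tendsto_aut_iff.2 hφ

instance : LocallyCompactSpace (Γ.graph ≃g Γ.graph) := by
  obtain ⟨x⟩ := Γ.connected.nonempty
  refine (isCompact_transporter x x).locallyCompactSpace_of_mem_nhds_of_group (x := 1)
    ((isOpen_transporter x x).mem_nhds rfl)

theorem stabOrbit_finite (x y : Γ.V) : (stabOrbit Γ.graph x y).Finite := by
  refine (Γ.ball_finite x (Γ.graph.dist x y)).subset ?_
  rintro z ⟨g, hx, rfl⟩
  rw [LFGraph.mem_ball]
  nth_rewrite 1 [← hx]
  rw [dist_map g]

theorem mem_stabOrbit_self (x y : Γ.V) : y ∈ stabOrbit Γ.graph x y := ⟨1, rfl, rfl⟩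

theorem ncard_stabOrbit_pos (x y : Γ.V) : 0 < (stabOrbit Γ.graph x y).ncard :=
  (Set.ncard_pos (stabOrbit_finite x y)).2 ⟨y, mem_stabOrbit_self x y⟩

/-! ### Haar measure and orbits of stabilizers -/

section Haar

variable (m : Measure (Γ.graph ≃g Γ.graph))

theorem haar_transporter_ne_zero [m.IsHaarMeasure] (x : Γ.V) :
    m (transporter Γ.graph x x) ≠ 0 :=
  (isOpen_transporter x x).measure_ne_zero m ⟨1, rfl⟩

theorem haar_transporter_ne_top [m.IsHaarMeasure] (x y : Γ.V) :
    m (transporter Γ.graph x y) ≠ ∞ :=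
  (isCompact_transporter x y).measure_ne_top

/-- The index of `G_x ∩ G_y` in `G_x` is the cardinality of the orbit `G_x y`. -/
theorem haar_stabilizer_eq [m.IsMulLeftInvariant] (x y : Γ.V) :
    m (transporter Γ.graph x x) = (stabOrbit Γ.graph x y).ncard *
      m (transporter Γ.graph x x ∩ transporter Γ.graph y y) := by
  have hU : transporter Γ.graph x x =
      ⋃ z ∈ stabOrbit Γ.graph x y, transporter Γ.graph x x ∩ transporter Γ.graph y z := by
    ext g
    simp only [Set.mem_iUnion, exists_prop]
    exact ⟨fun hg => ⟨g y, ⟨g, hg, rfl⟩, hg, rfl⟩, fun ⟨_, _, hg, _⟩ => hg⟩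
  -- The pieces are the left cosets of `G_x ∩ G_y` in `G_x`.
  have hm : ∀ z ∈ stabOrbit Γ.graph x y,
      m (transporter Γ.graph x x ∩ transporter Γ.graph y z) =
        m (transporter Γ.graph x x ∩ transporter Γ.graph y y) := by
    rintro z ⟨h, hx, rfl⟩
    rw [← measure_preimage_mul m h (transporter Γ.graph x x ∩ transporter Γ.graph y (h y))]
    congr 1
    ext g
    change h (g x) = x ∧ h (g y) = h y ↔ g x = x ∧ g y = y
    rw [h.injective.eq_iff]
    nth_rewrite 2 [← hx]
    rw [h.injective.eq_iff]
  have hfin := stabOrbit_finite x y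
  conv_lhs => rw [hU]
  rw [measure_biUnion hfin.countable]
  · have := hfin.fintype
    rw [tsum_fintype, Finset.sum_congr rfl fun (z : stabOrbit Γ.graph x y) _ => hm z z.2]
    rw [← Set.fintypeCard_eq_ncard]
    simp
  · intro z _ z' _ hne
    exact Set.disjoint_left.2 fun g hg hg' => hne (hg.2.symm.trans hg'.2)
  · intro z _
    exact ((isOpen_transporter _ _).inter (isOpen_transporter _ _)).measurableSet

/-- The modular cocycle is a quotient of Haar measures of stabilizers: the measure of
`G_x ∩ G_y` cancels. -/
theorem graphModularCocycle_eq_haar [m.IsHaarMeasure] (x y : Γ.V) :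
    graphModularCocycle Γ.graph x y =
      m (transporter Γ.graph x x) / m (transporter Γ.graph y y) := by
  have h0 : m (transporter Γ.graph x x ∩ transporter Γ.graph y y) ≠ 0 :=
    ((isOpen_transporter x x).inter (isOpen_transporter y y)).measure_ne_zero m ⟨1, rfl, rfl⟩
  have ht : m (transporter Γ.graph x x ∩ transporter Γ.graph y y) ≠ ∞ :=
    measure_ne_top_of_subset Set.inter_subset_left (haar_transporter_ne_top m x x)
  rw [haar_stabilizer_eq m x y, haar_stabilizer_eq m y x, Set.inter_comm (transporter _ y y),
    ENNReal.mul_div_mul_right _ _ h0 ht, graphModularCocycle]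

/-- Conjugate stabilizers have the same measure if the Haar measure is bi-invariant. -/
theorem haar_stabilizer_apply [m.IsMulLeftInvariant] [m.IsMulRightInvariant]
    (g : Γ.graph ≃g Γ.graph) (x : Γ.V) :
    m (transporter Γ.graph (g x) (g x)) = m (transporter Γ.graph x x) := by
  -- Both measures are those of the set of automorphisms that move `g x` to `x`.
  rw [← measure_preimage_mul_right m g (transporter Γ.graph x x), ← measure_preimage_mul m g]
  congr 1
  ext h
  exact g.injective.eq_iff (a := h (g x))

end Haar

/-- If the automorphism group is unimodular, then the modular cocycle only depends on the orbits
of its two arguments. -/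
theorem IsUnimodularGroup.graphModularCocycle_congr
    (h : IsUnimodularGroup (Γ.graph ≃g Γ.graph)) (x y : Γ.V) (g k : Γ.graph ≃g Γ.graph) :
    graphModularCocycle Γ.graph (g x) (k y) = graphModularCocycle Γ.graph x y := by
  obtain ⟨m, hm, hm'⟩ := h
  simp only [graphModularCocycle_eq_haar m, haar_stabilizer_apply m]

/-- The automorphism group is unimodular if the orbits `G_x y` and `G_y x` have the same size
whenever `y` is in the orbit of `x`: right translates of a Haar measure are multiples of it, and
the factor is found from the measures of a stabilizer and of its conjugate. -/
theorem isUnimodularGroup_of_ncard_stabOrbit_eq (x : Γ.V)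
    (h : ∀ g : Γ.graph ≃g Γ.graph,
      (stabOrbit Γ.graph x (g x)).ncard = (stabOrbit Γ.graph (g x) x).ncard) :
    IsUnimodularGroup (Γ.graph ≃g Γ.graph) := by
  have := Γ.countable
  have := secondCountableTopology_aut (Γ := Γ.graph)
  obtain ⟨K⟩ : Nonempty (TopologicalSpace.PositiveCompacts (Γ.graph ≃g Γ.graph)) := inferInstance
  let m := Measure.haarMeasure K
  have hm : m.IsHaarMeasure := Measure.isHaarMeasure_haarMeasure K
  have hstab : ∀ g : Γ.graph ≃g Γ.graph,
      m (transporter Γ.graph (g x) (g x)) = m (transporter Γ.graph x x) := fun g => by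
    rw [haar_stabilizer_eq m (g x) x, haar_stabilizer_eq m x (g x), h g, Set.inter_comm]
  refine ⟨m, hm, ⟨fun g => ?_⟩⟩
  -- The right translate of `m` is a multiple of `m`; the factor is `1` because both measures agree
  -- on the stabilizer of `x`.
  have e := Measure.isMulLeftInvariant_eq_smul (m.map (· * g)) m
  have e' : (m.map (· * g)) (transporter Γ.graph x x) = m (transporter Γ.graph x x) := by
    rw [Measure.map_apply (continuous_mul_const g).measurable
      (isOpen_transporter x x).measurableSet, ← hstab g,
      ← measure_preimage_mul m g (transporter Γ.graph (g x) (g x))]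
    congr 1
    ext h
    exact (g.injective.eq_iff (a := h (g x))).symm
  rw [e, Measure.smul_apply, ENNReal.smul_def, smul_eq_mul] at e'
  have hc := (ENNReal.mul_eq_right (haar_transporter_ne_zero m x)
    (haar_transporter_ne_top m x x)).1 e'
  rw [e, ENNReal.coe_eq_one.1 hc, one_smul]

/-! ### The kernel of counting measures on vertices -/

theorem measurableSet_rootDist (n : ℕ) : MeasurableSet {θ | rootDist θ = n} :=
  measurable_rootDist (measurableSet_singleton n)

theorem lintegral_fibreVertexCount {F : Gr₂ → ℝ≥0∞} (hF : Measurable F) (Γ : LFGraph) (x : Γ.V) :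
    ∫⁻ θ, F θ ∂fibreVertexCount (cls₁ Γ x) = ∑' y : Γ.V, F (cls₂ Γ x y) := by
  change ∫⁻ θ, F θ ∂(Measure.sum fun y : Γ.V => Measure.dirac (cls₂ Γ x y)) = _
  rw [lintegral_sum_measure]
  exact tsum_congr fun y => lintegral_dirac' _ hF

theorem fibreVertexCount_apply {S : Set Gr₂} (hS : MeasurableSet S) (Γ : LFGraph) (x : Γ.V) :
    fibreVertexCount (cls₁ Γ x) S = ∑' y : Γ.V, S.indicator 1 (cls₂ Γ x y) := by
  rw [← lintegral_indicator_one hS, lintegral_fibreVertexCount (measurable_one.indicator hS)]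

/-- The integral of a function that only depends on the ball of radius `R`, and that vanishes
if the secondary root lies outside of it, is locally constant. -/
theorem measurable_lintegral_of_ballIso₂ {F : Gr₂ → ℝ≥0∞} (hF : Measurable F) (R : ℕ)
    (h0 : ∀ θ, R < rootDist θ → F θ = 0)
    (h : ∀ (Γ Γ' : LFGraph) (x y : Γ.V) (x' y' : Γ'.V), Γ.graph.dist x y ≤ R →
      BallIso₂ R ⟨Γ, x, y⟩ ⟨Γ', x', y'⟩ → F (cls₂ Γ x y) = F (cls₂ Γ' x' y')) :
    Measurable fun ξ => ∫⁻ θ, F θ ∂fibreVertexCount ξ := by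
  intro U _
  refine IsOpen.measurableSet (isOpen_of_ballIso₁ fun Γ x hx => ⟨R, fun Γ' x' hb => ?_⟩)
  obtain ⟨a, b, hab⟩ := ballIso₁_iff.1 hb
  simp only [Set.mem_preimage] at hx ⊢
  rw [lintegral_fibreVertexCount hF] at hx ⊢
  have hsupp : ∀ (Γ : LFGraph) (x : Γ.V),
      ∑' y : Γ.V, F (cls₂ Γ x y) = ∑' y : Γ.ball x R, F (cls₂ Γ x y) := fun Γ x =>
    (tsum_subtype_eq_of_support_subset fun y hy => by
      by_contra hn
      exact hy (h0 _ (by simpa [LFGraph.mem_ball] using hn))).symm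
  rw [hsupp] at hx ⊢
  let e : Γ.ball x R ≃ Γ'.ball x' R :=
    ⟨fun u => ⟨a u, hab.map u u.2⟩, fun u => ⟨b u, hab.map' u u.2⟩,
      fun u => Subtype.ext (hab.left_inv u u.2), fun u => Subtype.ext (hab.right_inv u u.2)⟩
  rw [← e.tsum_eq]
  convert hx using 1
  refine tsum_congr fun u => (h _ _ _ _ _ _ u.2 (ballIso₂_iff.2 ⟨a, b, hab, fun v hv => ?_⟩)).symm
  exact ⟨fun e => congrArg a e, fun e => by
    rw [← hab.left_inv v hv, ← hab.left_inv u u.2]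
    exact congrArg b e⟩

/-- Two cylinders are either nested or disjoint. -/
theorem isPiSystem_cylinder₂ :
    IsPiSystem {U : Set Gr₂ | ∃ (G : DoublyRootedGraph) (r : ℕ), U = cylinder₂ G r} := by
  have key : ∀ (G H : DoublyRootedGraph) (r s : ℕ), r ≤ s →
      (cylinder₂ G r ∩ cylinder₂ H s).Nonempty →
      cylinder₂ G r ∩ cylinder₂ H s = cylinder₂ H s := by
    rintro G H r s hrs ⟨θ, hG, hH⟩
    refine Set.inter_eq_right.2 fun θ' hθ' => ?_
    obtain ⟨Γ, x, y, rfl⟩ := cls₂_surjective θ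
    obtain ⟨Γ', x', y', rfl⟩ := cls₂_surjective θ'
    rw [cls₂_mem_cylinder₂] at *
    exact hG.trans ((hH.symm.trans hθ').mono hrs)
  rintro _ ⟨G, r, rfl⟩ _ ⟨H, s, rfl⟩ hne
  rcases le_total r s with hrs | hrs
  · exact ⟨H, s, key G H r s hrs hne⟩
  · rw [Set.inter_comm] at hne ⊢
    exact ⟨G, r, key H G s r hrs hne⟩

theorem fibreVertexCount_rootDist_ne_top (ξ : Gr₁) (n : ℕ) :
    fibreVertexCount ξ {θ | rootDist θ = n} ≠ ∞ := by
  obtain ⟨Γ, x, rfl⟩ := cls₁_surjective ξ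
  rw [fibreVertexCount_apply (measurableSet_rootDist n)]
  have hsub : Function.support (fun y : Γ.V =>
      {θ | rootDist θ = n}.indicator (1 : Gr₂ → ℝ≥0∞) (cls₂ Γ x y)) ⊆ Γ.ball x n := by
    intro y hy
    have : cls₂ Γ x y ∈ {θ | rootDist θ = n} := by
      by_contra h
      exact hy (Set.indicator_of_notMem h _)
    exact LFGraph.mem_ball.2 (le_of_eq this)
  rw [← tsum_subtype_eq_of_support_subset hsub]
  have := (Γ.ball_finite x n).fintype
  rw [tsum_fintype]
  refine ENNReal.sum_ne_top.2 fun y _ => ?_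
  rw [Set.indicator_apply]
  split_ifs <;> simp

/-- The restrictions to spheres are finite measures, so their measurability may be checked on the
π-system of cylinders. -/
theorem measurable_fibreVertexCount_restrict (n : ℕ) :
    Measurable fun ξ => (fibreVertexCount ξ).restrict {θ | rootDist θ = n} := by
  have hn := measurableSet_rootDist n
  have : ∀ ξ, IsFiniteMeasure ((fibreVertexCount ξ).restrict {θ | rootDist θ = n}) := fun ξ =>
    ⟨by simpa using (fibreVertexCount_rootDist_ne_top ξ n).lt_top⟩
  have hborel : (inferInstance : MeasurableSpace Gr₂) = MeasurableSpace.generateFrom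
      {U : Set Gr₂ | ∃ (G : DoublyRootedGraph) (r : ℕ), U = cylinder₂ G r} :=
    borel_eq_generateFrom_of_subbasis rfl
  refine Measurable.measure_of_isPiSystem hborel isPiSystem_cylinder₂ ?_ ?_
  · rintro _ ⟨G, r, rfl⟩
    have hc := (isOpen_cylinder₂ G r).measurableSet
    simp only [Measure.restrict_apply hc, ← lintegral_indicator_one (hc.inter hn)]
    refine measurable_lintegral_of_ballIso₂ (measurable_one.indicator (hc.inter hn)) (max n r)
      (fun θ hθ => Set.indicator_of_notMem (fun h => ?_) _) fun Γ Γ' x y x' y' hd hb => ?_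
    · have := h.2.le
      omega
    · refine Set.indicator_eq_indicator ?_ rfl
      refine and_congr ?_ ?_
      · rw [cls₂_mem_cylinder₂, cls₂_mem_cylinder₂]
        have := hb.mono (le_max_right n r)
        exact ⟨fun h => h.trans this, fun h => h.trans this.symm⟩
      · change Γ.graph.dist x y = n ↔ Γ'.graph.dist x' y' = n
        rw [show Γ'.graph.dist x' y' = Γ.graph.dist x y from hb.dist_eq hd]
  · simp only [Measure.restrict_apply_univ, ← lintegral_indicator_one hn]
    refine measurable_lintegral_of_ballIso₂ (measurable_one.indicator hn) n
      (fun θ hθ => Set.indicator_of_notMem (s := {θ | rootDist θ = n}) (fun h => hθ.ne' h) _)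
      fun Γ Γ' x y x' y' hd hb => ?_
    refine Set.indicator_eq_indicator ?_ rfl
    change Γ.graph.dist x y = n ↔ Γ'.graph.dist x' y' = n
    rw [show Γ'.graph.dist x' y' = Γ.graph.dist x y from hb.dist_eq hd]

/-- A kernel of finite measures, not necessarily uniformly bounded, is s-finite. -/
theorem isSFiniteKernel_of_isFiniteMeasure {α β : Type*} [MeasurableSpace α] [MeasurableSpace β]
    (κ : Kernel α β) (h : ∀ a, IsFiniteMeasure (κ a)) : IsSFiniteKernel κ := by
  classical
  have hm : Measurable fun a => ⌈(κ a Set.univ).toNNReal⌉₊ :=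
    Nat.measurable_ceil.comp (κ.measurable_coe MeasurableSet.univ).ennreal_toNNReal
  have hs : ∀ k : ℕ, MeasurableSet {a | ⌈(κ a Set.univ).toNNReal⌉₊ = k} := fun k =>
    hm (measurableSet_singleton k)
  have hfin : ∀ k, IsFiniteKernel (Kernel.piecewise (hs k) κ 0) := fun k => by
    refine ⟨k, ENNReal.natCast_lt_top k, fun a => ?_⟩
    rw [Kernel.piecewise_apply]
    split_ifs with ha
    · have h1 := Nat.le_ceil (κ a Set.univ).toNNReal
      rw [show ⌈(κ a Set.univ).toNNReal⌉₊ = k from ha] at h1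
      rw [← ENNReal.coe_toNNReal (measure_ne_top (κ a) Set.univ)]
      exact_mod_cast h1
    · simp
  have hsum : κ = Kernel.sum fun k => Kernel.piecewise (hs k) κ 0 := by
    ext a t ht
    rw [Kernel.sum_apply' _ _ ht, tsum_eq_single ⌈(κ a Set.univ).toNNReal⌉₊]
    · simp [Kernel.piecewise_apply]
    · intro k hk
      rw [Kernel.piecewise_apply, if_neg (fun h => hk h.symm)]
      simp
  rw [hsum]
  infer_instance

/-- The restriction of the kernel of counting measures on vertices to the spheres of radius `n`. -/
noncomputable def sphereKernel (n : ℕ) : Kernel Gr₁ Gr₂ where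
  toFun ξ := (fibreVertexCount ξ).restrict {θ | rootDist θ = n}
  measurable' := measurable_fibreVertexCount_restrict n

instance (n : ℕ) : IsSFiniteKernel (sphereKernel n) :=
  isSFiniteKernel_of_isFiniteMeasure _ fun ξ =>
    ⟨by simpa [sphereKernel] using (fibreVertexCount_rootDist_ne_top ξ n).lt_top⟩

theorem sum_sphereKernel_apply (ξ : Gr₁) : Kernel.sum sphereKernel ξ = fibreVertexCount ξ := by
  rw [Kernel.sum_apply]
  change (Measure.sum fun n => (fibreVertexCount ξ).restrict {θ | rootDist θ = n}) = _
  rw [← Measure.restrict_iUnion (fun m n hmn => Set.disjoint_left.2 fun θ h h' => hmn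
    (h.symm.trans h')) measurableSet_rootDist]
  rw [Set.eq_univ_of_forall fun θ => Set.mem_iUnion.2 ⟨rootDist θ, rfl⟩, Measure.restrict_univ]

/-- The kernel of counting measures on vertices. -/
noncomputable def vertexKernel : Kernel Gr₁ Gr₂ where
  toFun := fibreVertexCount
  measurable' := by
    rw [← funext sum_sphereKernel_apply]
    exact (Kernel.sum sphereKernel).measurable

theorem vertexKernel_apply (ξ : Gr₁) : vertexKernel ξ = fibreVertexCount ξ := rfl

instance : IsSFiniteKernel vertexKernel := by
  rw [show vertexKernel = Kernel.sum sphereKernel from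
    Kernel.ext fun ξ => (sum_sphereKernel_apply ξ).symm]
  infer_instance

theorem measurable_fibreVertexCount : Measurable fibreVertexCount := vertexKernel.measurable

/-! ### Masses of atoms and sums over the fibres of `sigma` -/

theorem exists_cls₂_of_fstRoot_eq {Γ : LFGraph} {x : Γ.V} {θ : Gr₂} (h : fstRoot θ = cls₁ Γ x) :
    ∃ y, cls₂ Γ x y = θ := by
  obtain ⟨Γ', x', y', rfl⟩ := cls₂_surjective θ
  obtain ⟨φ, rfl⟩ := cls₁_eq_iff.1 h
  exact ⟨φ y', (cls₂_map φ x' y').symm⟩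

theorem countable_fstRoot_preimage (ξ : Gr₁) : (fstRoot ⁻¹' {ξ}).Countable := by
  obtain ⟨Γ, x, rfl⟩ := cls₁_surjective ξ
  have := Γ.countable
  exact (Set.countable_range (cls₂ Γ x)).mono fun θ hθ => exists_cls₂_of_fstRoot_eq hθ

theorem sigma_eq_iff {θ : Gr₂} {p : RelSpace} :
    sigma θ = p ↔ fstRoot θ = p.1.1 ∧ sndRoot θ = p.1.2 := by
  rw [Subtype.ext_iff, Prod.ext_iff]
  rfl

theorem sigma_surjective (p : RelSpace) : ∃ θ, sigma θ = p := by
  obtain ⟨Γ, x, y, hx, hy⟩ := p.2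
  exact ⟨cls₂ Γ x y, sigma_eq_iff.2 ⟨hx, hy⟩⟩

theorem sigma_rootSwap (θ : Gr₂) : sigma (rootSwap θ) = relSwap (sigma θ) := by
  obtain ⟨Γ, x, y, rfl⟩ := cls₂_surjective θ
  rfl

@[simp] theorem relSwap_relSwap (p : RelSpace) : relSwap (relSwap p) = p := rfl

theorem countable_sigma_preimage (p : RelSpace) : (sigma ⁻¹' {p}).Countable :=
  (countable_fstRoot_preimage p.1.1).mono fun _ hθ => (sigma_eq_iff.1 hθ).1

theorem measurableSet_sigma_preimage (p : RelSpace) : MeasurableSet (sigma ⁻¹' {p}) :=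
  measurable_sigma (measurableSet_singleton p)

theorem countable_rootMoving (ξ : Gr₁) : Countable {η : Gr₁ // rootMoving ξ η} := by
  have h : {η | rootMoving ξ η}.Countable :=
    ((countable_fstRoot_preimage ξ).image sndRoot).mono fun η hη => by
      obtain ⟨θ, hθ⟩ := sigma_surjective ⟨(ξ, η), hη⟩
      exact ⟨θ, (sigma_eq_iff.1 hθ).1, (sigma_eq_iff.1 hθ).2⟩
  exact h.to_subtype

theorem ae_fstRoot_eq (ξ : Gr₁) : ∀ᵐ θ ∂fibreVertexCount ξ, fstRoot θ = ξ := by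
  have hm : MeasurableSet {θ | ¬ fstRoot θ = ξ} :=
    (measurable_fstRoot (measurableSet_singleton ξ)).compl
  obtain ⟨Γ, x, rfl⟩ := cls₁_surjective ξ
  rw [ae_iff, fibreVertexCount_apply hm]
  simp

/-- The mass that the counting measure on vertices gives to the class of `(Γ, x, y)`; it is the
cardinality of `G_x y`. -/
noncomputable def mass (θ : Gr₂) : ℝ≥0∞ := fibreVertexCount (fstRoot θ) {θ}

theorem mass_cls₂ (Γ : LFGraph) (x y : Γ.V) :
    mass (cls₂ Γ x y) = (stabOrbit Γ.graph x y).ncard := by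
  have h : ∀ z, ({cls₂ Γ x y} : Set Gr₂).indicator (1 : Gr₂ → ℝ≥0∞) (cls₂ Γ x z) =
      (stabOrbit Γ.graph x y).indicator 1 z := fun z =>
    Set.indicator_eq_indicator (by
      rw [Set.mem_singleton_iff, eq_comm, cls₂_eq_iff]
      rfl) rfl
  rw [mass, fstRoot_cls₂, fibreVertexCount_apply (measurableSet_singleton _), tsum_congr h,
    ← tsum_subtype]
  have := (stabOrbit_finite x y).fintype
  rw [tsum_fintype, ← Set.fintypeCard_eq_ncard]
  simp

theorem mass_ne_zero (θ : Gr₂) : mass θ ≠ 0 := by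
  obtain ⟨Γ, x, y, rfl⟩ := cls₂_surjective θ
  rw [mass_cls₂]
  exact_mod_cast (ncard_stabOrbit_pos x y).ne'

theorem mass_ne_top (θ : Gr₂) : mass θ ≠ ∞ := by
  obtain ⟨Γ, x, y, rfl⟩ := cls₂_surjective θ
  rw [mass_cls₂]
  exact ENNReal.natCast_ne_top _

theorem modularFunction_eq (θ : Gr₂) : modularFunction θ = mass θ / mass (rootSwap θ) := by
  obtain ⟨Γ, x, y, rfl⟩ := cls₂_surjective θ
  rw [rootSwap_cls₂, mass_cls₂, mass_cls₂]
  rfl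

theorem measurable_mass : Measurable mass := by
  have := Kernel.measurable_kernel_prodMk_left (κ := vertexKernel.comap fstRoot measurable_fstRoot)
    (t := {q : Gr₂ × Gr₂ | q.2 = q.1}) (measurableSet_eq_fun measurable_snd measurable_fst)
  exact this

/-- The integral of a function against the counting measure on vertices, over a fibre of `sigma`. -/
noncomputable def fibreSum (F : Gr₂ → ℝ≥0∞) (p : RelSpace) : ℝ≥0∞ :=
  ∫⁻ θ in sigma ⁻¹' {p}, F θ ∂fibreVertexCount p.1.1

theorem fibreSum_eq_tsum (F : Gr₂ → ℝ≥0∞) (p : RelSpace) :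
    fibreSum F p = ∑' θ : sigma ⁻¹' {p}, F θ * mass θ := by
  rw [fibreSum, lintegral_countable _ (countable_sigma_preimage p)]
  refine tsum_congr fun θ => ?_
  rw [mass, (sigma_eq_iff.1 θ.2).1]

theorem measurable_fibreSum {F : Gr₂ → ℝ≥0∞} (hF : Measurable F) : Measurable (fibreSum F) := by
  have hp : Measurable fun p : RelSpace => p.1.1 := measurable_fst.comp measurable_subtype_coe
  have hq : Measurable fun p : RelSpace => p.1.2 := measurable_snd.comp measurable_subtype_coe
  have hs : MeasurableSet {u : RelSpace × Gr₂ | sigma u.2 = u.1} := by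
    simp only [sigma_eq_iff]
    exact (measurableSet_eq_fun (measurable_fstRoot.comp measurable_snd)
      (hp.comp measurable_fst)).inter (measurableSet_eq_fun
        (measurable_sndRoot.comp measurable_snd) (hq.comp measurable_fst))
  have := Measurable.lintegral_kernel_prod_right' (κ := vertexKernel.comap _ hp)
    ((hF.comp measurable_snd).indicator hs)
  convert this using 2 with p
  rw [fibreSum, ← lintegral_indicator (measurableSet_sigma_preimage p)]
  rfl

theorem fibreSum_comp_sigma_mul (H : RelSpace → ℝ≥0∞) (F : Gr₂ → ℝ≥0∞) (p : RelSpace) :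
    fibreSum (fun θ => H (sigma θ) * F θ) p = H p * fibreSum F p := by
  rw [fibreSum_eq_tsum, fibreSum_eq_tsum, ← ENNReal.tsum_mul_left]
  refine tsum_congr fun θ => ?_
  rw [show sigma θ = p from θ.2, mul_assoc]

/-- The exchange of the roots maps the fibre over `p` onto the fibre over `relSwap p`, but does not
preserve the masses. -/
theorem fibreSum_comp_rootSwap_eq_tsum (F : Gr₂ → ℝ≥0∞) (p : RelSpace) :
    fibreSum (fun θ => F (rootSwap θ)) p =
      ∑' θ : sigma ⁻¹' {relSwap p}, F θ * mass (rootSwap θ) := by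
  rw [fibreSum_eq_tsum]
  let e : sigma ⁻¹' {p} ≃ sigma ⁻¹' {relSwap p} :=
    ⟨fun θ => ⟨rootSwap θ, by
        change sigma (rootSwap θ) = relSwap p
        rw [sigma_rootSwap, show sigma θ = p from θ.2]⟩,
      fun θ => ⟨rootSwap θ, by
        change sigma (rootSwap θ) = p
        rw [sigma_rootSwap, show sigma θ = relSwap p from θ.2, relSwap_relSwap]⟩,
      fun θ => Subtype.ext (rootSwap_rootSwap θ), fun θ => Subtype.ext (rootSwap_rootSwap θ)⟩
  rw [← e.tsum_eq]
  refine tsum_congr fun θ => ?_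
  change _ = F (rootSwap θ) * mass (rootSwap (rootSwap θ))
  rw [rootSwap_rootSwap]

/-- Integration against the counting measure on vertices, fibre by fibre. -/
theorem lintegral_fibreVertexCount_eq_tsum (F : Gr₂ → ℝ≥0∞) (ξ : Gr₁) :
    ∫⁻ θ, F θ ∂fibreVertexCount ξ =
      ∑' η : {η : Gr₁ // rootMoving ξ η}, fibreSum F ⟨(ξ, η.1), η.2⟩ := by
  have := countable_rootMoving ξ
  have hU : (⋃ η : {η : Gr₁ // rootMoving ξ η}, sigma ⁻¹' {⟨(ξ, η.1), η.2⟩}) =ᵐ[fibreVertexCount ξ]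
      (Set.univ : Set Gr₂) := by
    rw [eventuallyEq_univ]
    filter_upwards [ae_fstRoot_eq ξ] with θ hθ
    subst hθ
    exact Set.mem_iUnion.2 ⟨⟨sndRoot θ, (sigma θ).2⟩, rfl⟩
  rw [← setLIntegral_univ, ← setLIntegral_congr hU,
    lintegral_iUnion fun η => measurableSet_sigma_preimage _]
  · rfl
  · intro η η' hne
    refine Set.disjoint_left.2 fun θ h h' => hne (Subtype.ext ?_)
    exact ((sigma_eq_iff.1 h).2.symm.trans (sigma_eq_iff.1 h').2)

theorem lintegral_fibreCount {H : RelSpace → ℝ≥0∞} (hH : Measurable H) (ξ : Gr₁) :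
    ∫⁻ p, H p ∂fibreCount ξ = ∑' η : {η : Gr₁ // rootMoving ξ η}, H ⟨(ξ, η.1), η.2⟩ := by
  rw [fibreCount, lintegral_sum_measure]
  exact tsum_congr fun η => lintegral_dirac' _ hH

/-! ### A normalized weight on the fibres of `sigma` -/

/-- The function that distributes a mass of at most `2⁻¹ ^ n` uniformly over the sphere of
radius `n`. -/
noncomputable def sphereWeight (n : ℕ) : Gr₂ → ℝ≥0∞ :=
  {θ | rootDist θ = n}.indicator
    (fun θ => 2⁻¹ ^ n * (1 + fibreVertexCount (fstRoot θ) {θ | rootDist θ = n})⁻¹)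

theorem measurable_sphereWeight (n : ℕ) : Measurable (sphereWeight n) := by
  refine Measurable.indicator ?_ (measurableSet_rootDist n)
  refine Measurable.const_mul (Measurable.inv (Measurable.const_add ?_ _)) _
  exact (vertexKernel.measurable_coe (measurableSet_rootDist n)).comp measurable_fstRoot

theorem lintegral_sphereWeight_le (n : ℕ) (ξ : Gr₁) :
    ∫⁻ θ, sphereWeight n θ ∂fibreVertexCount ξ ≤ 2⁻¹ ^ n := by
  have h : ∀ᵐ θ ∂fibreVertexCount ξ, sphereWeight n θ = {θ | rootDist θ = n}.indicator
      (fun _ => 2⁻¹ ^ n * (1 + fibreVertexCount ξ {θ | rootDist θ = n})⁻¹) θ := by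
    filter_upwards [ae_fstRoot_eq ξ] with θ hθ
    simp only [sphereWeight, Set.indicator_apply, hθ]
  rw [lintegral_congr_ae h, lintegral_indicator_const (measurableSet_rootDist n), mul_assoc]
  refine mul_le_of_le_one_right' ?_
  rw [mul_comm, ← div_eq_mul_inv]
  exact ENNReal.div_le_of_le_mul (by rw [one_mul]; exact le_add_self)

/-- A positive function whose integrals against the counting measures on vertices are
at most `2`. -/
noncomputable def vertexWeight (θ : Gr₂) : ℝ≥0∞ := ∑' n : ℕ, sphereWeight n θ

theorem measurable_vertexWeight : Measurable vertexWeight :=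
  Measurable.tsum measurable_sphereWeight

theorem vertexWeight_ne_zero (θ : Gr₂) : vertexWeight θ ≠ 0 := by
  intro h
  have := ENNReal.tsum_eq_zero.1 h (rootDist θ)
  rw [sphereWeight, Set.indicator_of_mem (by rfl)] at this
  have h2 : 1 + fibreVertexCount (fstRoot θ) {θ' | rootDist θ' = rootDist θ} ≠ ∞ :=
    ENNReal.add_ne_top.2 ⟨ENNReal.one_ne_top, fibreVertexCount_rootDist_ne_top _ _⟩
  rcases mul_eq_zero.1 this with h' | h'
  · exact (ENNReal.pow_pos (by simp) _).ne' h'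
  · exact h2 (ENNReal.inv_eq_zero.1 h')

theorem lintegral_vertexWeight_le (ξ : Gr₁) : ∫⁻ θ, vertexWeight θ ∂fibreVertexCount ξ ≤ 2 := by
  simp only [vertexWeight]
  rw [lintegral_tsum fun n => (measurable_sphereWeight n).aemeasurable,
    ← ENNReal.tsum_geometric_two]
  exact ENNReal.tsum_le_tsum fun n => lintegral_sphereWeight_le n ξ

theorem fibreSum_vertexWeight_ne_top (p : RelSpace) : fibreSum vertexWeight p ≠ ∞ :=
  (((setLIntegral_le_lintegral _ _).trans (lintegral_vertexWeight_le p.1.1)).trans_lt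
    ENNReal.ofNat_lt_top).ne

theorem fibreSum_vertexWeight_ne_zero (p : RelSpace) : fibreSum vertexWeight p ≠ 0 := by
  obtain ⟨θ, hθ⟩ := sigma_surjective p
  rw [fibreSum_eq_tsum]
  intro h
  exact mul_ne_zero (vertexWeight_ne_zero θ) (mass_ne_zero θ)
    (ENNReal.tsum_eq_zero.1 h ⟨θ, hθ⟩)

/-- A weight with total mass `1` on each fibre of `sigma`. -/
noncomputable def fibreWeight (θ : Gr₂) : ℝ≥0∞ :=
  (fibreSum vertexWeight (sigma θ))⁻¹ * vertexWeight θ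

theorem measurable_fibreWeight : Measurable fibreWeight :=
  ((measurable_fibreSum measurable_vertexWeight).comp measurable_sigma).inv.mul
    measurable_vertexWeight

theorem fibreSum_fibreWeight (p : RelSpace) : fibreSum fibreWeight p = 1 := by
  have := fibreSum_comp_sigma_mul (fun p => (fibreSum vertexWeight p)⁻¹) vertexWeight p
  exact this.trans (ENNReal.inv_mul_cancel (fibreSum_vertexWeight_ne_zero p)
    (fibreSum_vertexWeight_ne_top p))

/-! ### The counting measures -/

/-- The counting measure on a fibre of the equivalence relation is the image under `sigma` of the
counting measure on vertices with density `fibreWeight`. -/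
theorem lintegral_comp_sigma_mul_fibreWeight {H : RelSpace → ℝ≥0∞} (hH : Measurable H) (ξ : Gr₁) :
    ∫⁻ θ, H (sigma θ) * fibreWeight θ ∂fibreVertexCount ξ = ∫⁻ p, H p ∂fibreCount ξ := by
  rw [lintegral_fibreVertexCount_eq_tsum, lintegral_fibreCount hH]
  refine tsum_congr fun η => ?_
  rw [fibreSum_comp_sigma_mul, fibreSum_fibreWeight, mul_one]

theorem measurable_fibreCount : Measurable fibreCount := by
  refine Measure.measurable_of_measurable_coe _ fun B hB => ?_
  have hm : Measurable (B.indicator (1 : RelSpace → ℝ≥0∞)) := measurable_one.indicator hB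
  have h : ∀ ξ, fibreCount ξ B =
      ∫⁻ θ, B.indicator 1 (sigma θ) * fibreWeight θ ∂vertexKernel ξ := fun ξ => by
    rw [vertexKernel_apply, lintegral_comp_sigma_mul_fibreWeight hm, lintegral_indicator_one hB]
  simp only [h]
  exact ((hm.comp measurable_sigma).mul measurable_fibreWeight).lintegral_kernel

theorem lintegral_relCountingMeasure (μ : Measure Gr₁) {H : RelSpace → ℝ≥0∞} (hH : Measurable H) :
    ∫⁻ p, H p ∂relCountingMeasure μ = ∫⁻ ξ, ∫⁻ p, H p ∂fibreCount ξ ∂μ :=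
  Measure.lintegral_bind measurable_fibreCount.aemeasurable hH.aemeasurable

theorem lintegral_doubleCountingMeasure (μ : Measure Gr₁) {F : Gr₂ → ℝ≥0∞} (hF : Measurable F) :
    ∫⁻ θ, F θ ∂doubleCountingMeasure μ = ∫⁻ ξ, ∫⁻ θ, F θ ∂fibreVertexCount ξ ∂μ :=
  Measure.lintegral_bind measurable_fibreVertexCount.aemeasurable hF.aemeasurable

/-- The disintegration of the counting measure on doubly rooted graphs over the one on the
equivalence relation. -/
theorem lintegral_fibreSum (μ : Measure Gr₁) {F : Gr₂ → ℝ≥0∞} (hF : Measurable F) :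
    ∫⁻ p, fibreSum F p ∂relCountingMeasure μ = ∫⁻ θ, F θ ∂doubleCountingMeasure μ := by
  rw [lintegral_relCountingMeasure μ (measurable_fibreSum hF),
    lintegral_doubleCountingMeasure μ hF]
  refine lintegral_congr fun ξ => ?_
  rw [lintegral_fibreCount (measurable_fibreSum hF), lintegral_fibreVertexCount_eq_tsum]

theorem ae_relCountingMeasure_of_ae {μ : Measure Gr₁} {P : Gr₁ → Prop} (h : ∀ᵐ ξ ∂μ, P ξ) :
    ∀ᵐ p ∂relCountingMeasure μ, P p.1.1 := by
  obtain ⟨N, hN, hNm, hN0⟩ := exists_measurable_superset_of_null (ae_iff.1 h)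
  have hp : Measurable fun p : RelSpace => p.1.1 := measurable_fst.comp measurable_subtype_coe
  have h0 : relCountingMeasure μ ((fun p => p.1.1) ⁻¹' N) = 0 := by
    rw [← lintegral_indicator_one (hp hNm),
      lintegral_relCountingMeasure μ (measurable_one.indicator (hp hNm)),
      lintegral_eq_zero_iff' (by
        exact (Measure.measurable_lintegral
          (measurable_one.indicator (hp hNm))).comp measurable_fibreCount |>.aemeasurable)]
    filter_upwards [compl_mem_ae_iff.2 hN0] with ξ hξ
    rw [lintegral_fibreCount (measurable_one.indicator (hp hNm))]
    refine ENNReal.tsum_eq_zero.2 fun η => Set.indicator_of_notMem (fun h => ?_) _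
    exact hξ h
  filter_upwards [compl_mem_ae_iff.2 h0] with p hp'
  by_contra hn
  exact hp' (hN hn)

theorem sigmaFinite_relCountingMeasure (μ : Measure Gr₁) [SigmaFinite μ] :
    SigmaFinite (relCountingMeasure μ) := by
  obtain ⟨g, hg0, hgm, hg⟩ := exists_pos_lintegral_lt_of_sigmaFinite μ one_ne_zero
  have hgm' : Measurable fun ξ => (g ξ : ℝ≥0∞) := hgm.coe_nnreal_ennreal
  -- It suffices to find a positive finite function `b` with a finite integral; that of the function
  -- chosen here is at most `2 * ∫ g dμ`.
  let b : RelSpace → ℝ≥0∞ := fibreSum fun θ => g (fstRoot θ) * vertexWeight θ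
  have hFm : Measurable fun θ => (g (fstRoot θ) : ℝ≥0∞) * vertexWeight θ :=
    (hgm'.comp measurable_fstRoot).mul measurable_vertexWeight
  have hbm : Measurable b := measurable_fibreSum hFm
  have hb : ∀ p, b p = g p.1.1 * fibreSum vertexWeight p := fun p =>
    fibreSum_comp_sigma_mul (fun p => (g p.1.1 : ℝ≥0∞)) vertexWeight p
  have hb0 : ∀ p, b p ≠ 0 := fun p => by
    rw [hb]
    exact mul_ne_zero (ENNReal.coe_ne_zero.2 (hg0 _).ne') (fibreSum_vertexWeight_ne_zero p)
  have hbt : ∀ p, b p ≠ ∞ := fun p => by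
    rw [hb]
    exact ENNReal.mul_ne_top ENNReal.coe_ne_top (fibreSum_vertexWeight_ne_top p)
  have hfin : ∫⁻ p, b p ∂relCountingMeasure μ ≠ ∞ := by
    rw [lintegral_fibreSum μ hFm, lintegral_doubleCountingMeasure μ hFm]
    have h : ∀ ξ, ∫⁻ θ, g (fstRoot θ) * vertexWeight θ ∂fibreVertexCount ξ ≤ g ξ * 2 := fun ξ => by
      have : ∀ᵐ θ ∂fibreVertexCount ξ,
          (g (fstRoot θ) : ℝ≥0∞) * vertexWeight θ = g ξ * vertexWeight θ := by
        filter_upwards [ae_fstRoot_eq ξ] with θ hθ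
        rw [hθ]
      rw [lintegral_congr_ae this, lintegral_const_mul _ measurable_vertexWeight]
      gcongr
      exact lintegral_vertexWeight_le ξ
    refine ((lintegral_mono h).trans_lt ?_).ne
    rw [lintegral_mul_const _ hgm']
    exact ENNReal.mul_lt_top (hg.trans ENNReal.one_lt_top) ENNReal.ofNat_lt_top
  have : IsFiniteMeasure ((relCountingMeasure μ).withDensity b) := isFiniteMeasure_withDensity hfin
  rw [← withDensity_inv_same (μ := relCountingMeasure μ) hbm (ae_of_all _ hb0) (ae_of_all _ hbt)]
  exact SigmaFinite.withDensity_of_ne_top (ae_of_all _ fun p => ENNReal.inv_ne_top.2 (hb0 p))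

/-! ### The modular cocycle over graphs with unimodular automorphism groups -/

/-- Over `unimodularAutSet` the modular function is constant on the fibres of `sigma`. -/
theorem modularFunction_eq_of_sigma_eq {θ θ' : Gr₂} (h : fstRoot θ ∈ unimodularAutSet)
    (hσ : sigma θ = sigma θ') : modularFunction θ = modularFunction θ' := by
  obtain ⟨Γ, x, hG, hx⟩ := h
  obtain ⟨h1, h2⟩ := sigma_eq_iff.1 hσ
  change fstRoot θ = fstRoot θ' at h1
  change sndRoot θ = sndRoot θ' at h2
  obtain ⟨y, rfl⟩ := exists_cls₂_of_fstRoot_eq hx.symm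
  obtain ⟨y', rfl⟩ := exists_cls₂_of_fstRoot_eq (h1.symm.trans hx.symm)
  obtain ⟨g, hg⟩ := cls₁_eq_iff.1 h2
  change g y = y' at hg
  rw [← hg]
  exact (hG.graphModularCocycle_congr x y 1 g).symm

theorem modularCocycle_sigma {θ : Gr₂} (h : fstRoot θ ∈ unimodularAutSet) :
    modularCocycle (sigma θ) = modularFunction θ := by
  classical
  have hex : ∃ θ', sigma θ' = sigma θ := ⟨θ, rfl⟩
  rw [modularCocycle, Function.extend_def, dif_pos hex]
  exact (modularFunction_eq_of_sigma_eq h hex.choose_spec.symm).symm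

theorem modularCocycle_ne_zero {p : RelSpace} (h : p.1.1 ∈ unimodularAutSet) :
    modularCocycle p ≠ 0 := by
  obtain ⟨θ, rfl⟩ := sigma_surjective p
  rw [modularCocycle_sigma h, modularFunction_eq]
  exact (ENNReal.div_pos (mass_ne_zero _) (mass_ne_top _)).ne'

/-- Exchanging the roots multiplies the fibre sums by the modular cocycle. -/
theorem fibreSum_comp_rootSwap (F : Gr₂ → ℝ≥0∞) {p : RelSpace} (h : p.1.1 ∈ unimodularAutSet) :
    fibreSum (fun θ => F (rootSwap θ)) p = modularCocycle p * fibreSum F (relSwap p) := by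
  have hswap := fibreSum_comp_rootSwap_eq_tsum (fun θ => F (rootSwap θ)) (relSwap p)
  simp only [rootSwap_rootSwap] at hswap
  rw [fibreSum_eq_tsum, hswap, relSwap_relSwap, ← ENNReal.tsum_mul_left]
  refine tsum_congr fun θ => ?_
  have hθ : sigma θ = p := θ.2
  have hm : mass θ = modularCocycle p * mass (rootSwap θ) := by
    have h' : fstRoot (θ : Gr₂) ∈ unimodularAutSet := by rwa [(sigma_eq_iff.1 hθ).1]
    have h'' := modularCocycle_sigma h'
    rw [hθ] at h''
    rw [h'', modularFunction_eq,
      ENNReal.div_mul_cancel (mass_ne_zero _) (mass_ne_top _)]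
  rw [hm]
  ring

/-! ### Unimodular measures -/

variable {μ : Measure Gr₁}

theorem IsUnimodular.lintegral_comp_rootSwap (hμ : IsUnimodular μ) {F : Gr₂ → ℝ≥0∞}
    (hF : Measurable F) :
    ∫⁻ θ, F (rootSwap θ) ∂doubleCountingMeasure μ = ∫⁻ θ, F θ ∂doubleCountingMeasure μ := by
  rw [← lintegral_map hF measurable_rootSwap, hμ]

/-- The set of doubly rooted graphs `(Γ, x, y)` such that `y` is in the orbit of `x` under the
automorphism group, but the orbit `G_x y` is smaller than `G_y x`. -/
def asymmetricSet : Set Gr₂ := {θ | fstRoot θ = sndRoot θ ∧ mass θ < mass (rootSwap θ)}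

theorem measurableSet_asymmetricSet : MeasurableSet asymmetricSet :=
  (measurableSet_eq_fun measurable_fstRoot measurable_sndRoot).inter
    (measurableSet_lt measurable_mass (measurable_mass.comp measurable_rootSwap))

theorem lintegral_fibreVertexCount_of_diag {F : Gr₂ → ℝ≥0∞}
    (hF : ∀ θ, fstRoot θ ≠ sndRoot θ → F θ = 0) (ξ : Gr₁) :
    ∫⁻ θ, F θ ∂fibreVertexCount ξ = fibreSum F ⟨(ξ, ξ), rootMoving.refl ξ⟩ := by
  rw [lintegral_fibreVertexCount_eq_tsum, tsum_eq_single ⟨ξ, rootMoving.refl ξ⟩]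
  rintro ⟨η, hη⟩ hne
  rw [fibreSum_eq_tsum]
  refine ENNReal.tsum_eq_zero.2 fun θ => ?_
  obtain ⟨h1, h2⟩ := sigma_eq_iff.1 θ.2
  rw [hF θ (fun h => hne (Subtype.ext (h2.symm.trans (h.symm.trans h1)))), zero_mul]

/-- For a unimodular measure, the invariance of the counting measure on doubly rooted graphs
descends to almost every fibre over the diagonal of the equivalence relation. -/
theorem IsUnimodular.ae_fibreSum_diag [SigmaFinite μ] (hμ : IsUnimodular μ) {F : Gr₂ → ℝ≥0∞}
    (hFm : Measurable F) (hF : ∀ θ, fstRoot θ ≠ sndRoot θ → F θ = 0) :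
    ∀ᵐ ξ ∂μ, fibreSum (fun θ => F (rootSwap θ)) ⟨(ξ, ξ), rootMoving.refl ξ⟩ =
      fibreSum F ⟨(ξ, ξ), rootMoving.refl ξ⟩ := by
  classical
  have hF' : ∀ θ, fstRoot θ ≠ sndRoot θ → F (rootSwap θ) = 0 := fun θ h =>
    hF _ (by rw [fstRoot_rootSwap, sndRoot_rootSwap]; exact h.symm)
  have hFm' : Measurable fun θ => F (rootSwap θ) := hFm.comp measurable_rootSwap
  simp only [← lintegral_fibreVertexCount_of_diag hF, ← lintegral_fibreVertexCount_of_diag hF']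
  have hL : ∀ {F : Gr₂ → ℝ≥0∞}, Measurable F →
      Measurable fun ξ => ∫⁻ θ, F θ ∂fibreVertexCount ξ := fun {F} hF =>
    hF.lintegral_kernel (κ := vertexKernel)
  have key : ∀ {F : Gr₂ → ℝ≥0∞}, Measurable F → ∀ {A : Set Gr₁}, MeasurableSet A →
      ∫⁻ ξ in A, ∫⁻ θ, F θ ∂fibreVertexCount ξ ∂μ =
        ∫⁻ θ, (fstRoot ⁻¹' A).indicator F θ ∂doubleCountingMeasure μ := by
    intro F hF A hA
    rw [lintegral_doubleCountingMeasure μ (hF.indicator (measurable_fstRoot hA)),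
      ← lintegral_indicator hA]
    refine lintegral_congr fun ξ => ?_
    have : ∀ᵐ θ ∂fibreVertexCount ξ, (fstRoot ⁻¹' A).indicator F θ =
        A.indicator (fun _ => F θ) ξ := by
      filter_upwards [ae_fstRoot_eq ξ] with θ hθ
      simp only [Set.indicator_apply, Set.mem_preimage, hθ]
    rw [lintegral_congr_ae this]
    by_cases hξ : ξ ∈ A <;> simp [hξ]
  refine ae_eq_of_forall_setLIntegral_eq_of_sigmaFinite (hL hFm') (hL hFm) fun A hA _ => ?_
  rw [key hFm' hA, key hFm hA,
    ← hμ.lintegral_comp_rootSwap (hFm.indicator (measurable_fstRoot hA))]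
  refine lintegral_congr fun θ => ?_
  by_cases h : fstRoot θ = sndRoot θ
  · simp only [Set.indicator_apply, Set.mem_preimage, fstRoot_rootSwap, h]
  · simp only [Set.indicator_apply, hF' θ h, ite_self]

/-- A unimodular measure is concentrated on graphs with unimodular automorphism groups. -/
theorem IsUnimodular.ae_mem_unimodularAutSet [SigmaFinite μ] (hμ : IsUnimodular μ) :
    ∀ᵐ ξ ∂μ, ξ ∈ unimodularAutSet := by
  have hae := hμ.ae_fibreSum_diag (F := asymmetricSet.indicator vertexWeight)
    (measurable_vertexWeight.indicator measurableSet_asymmetricSet)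
    fun θ h => Set.indicator_of_notMem (fun h' => h h'.1) _
  filter_upwards [hae] with ξ hξ
  rw [fibreSum_comp_rootSwap_eq_tsum] at hξ
  let p : RelSpace := ⟨(ξ, ξ), rootMoving.refl ξ⟩
  change ∑' θ : sigma ⁻¹' {p}, _ = fibreSum _ p at hξ
  -- In the equation `hξ` the sums are compared term by term: they are finite, so `asymmetricSet`
  -- cannot meet the fibre over the diagonal point `p`.
  have hsym : ∀ θ, sigma θ = p → mass (rootSwap θ) ≤ mass θ := by
    intro θ hθ
    by_contra! hlt
    have hD : θ ∈ asymmetricSet :=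
      ⟨(sigma_eq_iff.1 hθ).1.trans (sigma_eq_iff.1 hθ).2.symm, hlt⟩
    have hfin : fibreSum (asymmetricSet.indicator vertexWeight) p ≠ ∞ :=
      ((lintegral_mono fun θ => Set.indicator_le_self _ _ _).trans_lt
        (fibreSum_vertexWeight_ne_top p).lt_top).ne
    have hlt' : fibreSum (asymmetricSet.indicator vertexWeight) p <
        ∑' θ : sigma ⁻¹' {p}, asymmetricSet.indicator vertexWeight θ * mass (rootSwap θ) := by
      rw [fibreSum_eq_tsum] at hfin ⊢
      refine ENNReal.tsum_lt_tsum (i := ⟨θ, hθ⟩) hfin (fun θ' => ?_) ?_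
      · by_cases h : (θ' : Gr₂) ∈ asymmetricSet
        · gcongr
          exact h.2.le
        · simp [h]
      · simp only [Set.indicator_of_mem hD]
        refine ENNReal.mul_lt_mul_right (vertexWeight_ne_zero θ) ?_ hlt
        intro ht
        have := ENNReal.ne_top_of_tsum_ne_top hfin ⟨θ, hθ⟩
        simp only [Set.indicator_of_mem hD, ht, ENNReal.top_mul (mass_ne_zero θ)] at this
        exact this rfl
    exact hlt'.ne' hξ
  obtain ⟨Γ, x, hx⟩ := cls₁_surjective ξ
  refine ⟨Γ, x, isUnimodularGroup_of_ncard_stabOrbit_eq x fun g => ?_, hx⟩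
  have hg : cls₁ Γ (g x) = ξ := by rw [← hx, cls₁_map g x]
  have h1 := hsym (cls₂ Γ x (g x)) (sigma_eq_iff.2 ⟨hx, hg⟩)
  have h2 := hsym (cls₂ Γ (g x) x) (sigma_eq_iff.2 ⟨hg, hx⟩)
  rw [rootSwap_cls₂, mass_cls₂, mass_cls₂] at h1 h2
  exact le_antisymm (by exact_mod_cast h2) (by exact_mod_cast h1)

/-- For a unimodular measure, the image under the involution of the counting measure on the
equivalence relation has a measurable density: the fibre sums of the swapped weight. -/
theorem IsUnimodular.map_relSwap_eq (hμ : IsUnimodular μ) :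
    (relCountingMeasure μ).map relSwap =
      (relCountingMeasure μ).withDensity (fibreSum fun θ => fibreWeight (rootSwap θ)) := by
  have hWm : Measurable fun θ => fibreWeight (rootSwap θ) :=
    measurable_fibreWeight.comp measurable_rootSwap
  ext B hB
  have hI : Measurable (B.indicator (1 : RelSpace → ℝ≥0∞)) := measurable_one.indicator hB
  have hm1 : Measurable fun θ => B.indicator (1 : RelSpace → ℝ≥0∞) (relSwap (sigma θ)) *
      fibreWeight θ :=
    ((hI.comp measurable_relSwap).comp measurable_sigma).mul measurable_fibreWeight
  have hm2 : Measurable fun θ => B.indicator (1 : RelSpace → ℝ≥0∞) (sigma θ) *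
      fibreWeight (rootSwap θ) := (hI.comp measurable_sigma).mul hWm
  have e1 : ∀ p, (relSwap ⁻¹' B).indicator (1 : RelSpace → ℝ≥0∞) p =
      fibreSum (fun θ => B.indicator 1 (relSwap (sigma θ)) * fibreWeight θ) p := fun p => by
    rw [fibreSum_comp_sigma_mul (fun p => B.indicator 1 (relSwap p)), fibreSum_fibreWeight,
      mul_one]
    rfl
  have e2 : ∀ p, B.indicator (fibreSum fun θ => fibreWeight (rootSwap θ)) p =
      fibreSum (fun θ => B.indicator 1 (sigma θ) * fibreWeight (rootSwap θ)) p := fun p => by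
    rw [fibreSum_comp_sigma_mul (B.indicator 1)]
    by_cases h : p ∈ B <;> simp [h]
  rw [Measure.map_apply measurable_relSwap hB, withDensity_apply _ hB,
    ← lintegral_indicator_one (measurable_relSwap hB), ← lintegral_indicator hB,
    lintegral_congr e1, lintegral_congr e2, lintegral_fibreSum μ hm1, lintegral_fibreSum μ hm2,
    ← hμ.lintegral_comp_rootSwap hm2]
  simp only [sigma_rootSwap, rootSwap_rootSwap]

theorem IsUnimodular.ae_fibreSum_eq_modularCocycle [SigmaFinite μ] (hμ : IsUnimodular μ) :
    ∀ᵐ p ∂relCountingMeasure μ, p.1.1 ∈ unimodularAutSet ∧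
      fibreSum (fun θ => fibreWeight (rootSwap θ)) p = modularCocycle p := by
  filter_upwards [ae_relCountingMeasure_of_ae hμ.ae_mem_unimodularAutSet] with p hp
  exact ⟨hp, by rw [fibreSum_comp_rootSwap _ hp, fibreSum_fibreWeight, mul_one]⟩

theorem IsUnimodular.isQuasiInvariant [SigmaFinite μ] (hμ : IsUnimodular μ) :
    IsQuasiInvariant μ := by
  have hm : Measurable (fibreSum fun θ => fibreWeight (rootSwap θ)) :=
    measurable_fibreSum (measurable_fibreWeight.comp measurable_rootSwap)
  rw [IsQuasiInvariant, hμ.map_relSwap_eq]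
  refine ⟨withDensity_absolutelyContinuous _ _,
    withDensity_absolutelyContinuous' hm.aemeasurable ?_⟩
  filter_upwards [hμ.ae_fibreSum_eq_modularCocycle] with p hp
  rw [hp.2]
  exact modularCocycle_ne_zero hp.1

theorem IsUnimodular.radonNikodymCocycle_ae_eq [SigmaFinite μ] (hμ : IsUnimodular μ) :
    radonNikodymCocycle μ =ᵐ[relCountingMeasure μ] modularCocycle := by
  have := sigmaFinite_relCountingMeasure μ
  have hm : Measurable (fibreSum fun θ => fibreWeight (rootSwap θ)) :=
    measurable_fibreSum (measurable_fibreWeight.comp measurable_rootSwap)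
  rw [radonNikodymCocycle, hμ.map_relSwap_eq]
  filter_upwards [Measure.rnDeriv_withDensity (relCountingMeasure μ) hm,
    hμ.ae_fibreSum_eq_modularCocycle] with p hp hp'
  rw [hp, hp'.2]

/-- Invariance of the counting measure on doubly rooted graphs is tested on the fibre sums, which
the exchange of the roots multiplies by the Radon-Nikodym cocycle. -/
theorem isUnimodular_of_radonNikodymCocycle [SigmaFinite μ]
    (h1 : ∀ᵐ ξ ∂μ, ξ ∈ unimodularAutSet) (h2 : IsQuasiInvariant μ)
    (h3 : ∀ᵐ p ∂relCountingMeasure μ,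
      p.1.1 ∈ unimodularAutSet → radonNikodymCocycle μ p = modularCocycle p) :
    IsUnimodular μ := by
  have := sigmaFinite_relCountingMeasure μ
  have hRN : (relCountingMeasure μ).withDensity (radonNikodymCocycle μ) =
      (relCountingMeasure μ).map relSwap := Measure.withDensity_rnDeriv_eq _ _ h2.1
  have hR : Measurable (radonNikodymCocycle μ) := Measure.measurable_rnDeriv _ _
  refine Measure.ext fun B hB => ?_
  have hI : Measurable (B.indicator (1 : Gr₂ → ℝ≥0∞)) := measurable_one.indicator hB
  have hS : Measurable fun p => fibreSum (B.indicator 1) (relSwap p) :=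
    (measurable_fibreSum hI).comp measurable_relSwap
  calc (doubleCountingMeasure μ).map rootSwap B
      = ∫⁻ θ, B.indicator 1 (rootSwap θ) ∂doubleCountingMeasure μ := by
        rw [← lintegral_map hI measurable_rootSwap, lintegral_indicator_one hB]
    _ = ∫⁻ p, fibreSum (fun θ => B.indicator 1 (rootSwap θ)) p ∂relCountingMeasure μ :=
        (lintegral_fibreSum μ (hI.comp measurable_rootSwap)).symm
    _ = ∫⁻ p, (radonNikodymCocycle μ * fun p => fibreSum (B.indicator 1) (relSwap p)) p
          ∂relCountingMeasure μ := by
        refine lintegral_congr_ae ?_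
        filter_upwards [ae_relCountingMeasure_of_ae h1, h3] with p hp hp'
        rw [fibreSum_comp_rootSwap _ hp, Pi.mul_apply, hp' hp]
    _ = ∫⁻ p, fibreSum (B.indicator 1) (relSwap p) ∂(relCountingMeasure μ).map relSwap := by
        rw [← hRN, lintegral_withDensity_eq_lintegral_mul _ hR hS]
    _ = ∫⁻ p, fibreSum (B.indicator 1) p ∂relCountingMeasure μ := by
        rw [lintegral_map hS measurable_relSwap]
        simp only [relSwap_relSwap]
    _ = doubleCountingMeasure μ B := by
        rw [lintegral_fibreSum μ hI, lintegral_indicator_one hB]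

end RandomGraph

theorem mainTheorem1 (μ : MeasureTheory.Measure RandomGraph.Gr₁) [MeasureTheory.SigmaFinite μ] :
    RandomGraph.IsUnimodular μ ↔
      (∀ᵐ ξ ∂μ, ξ ∈ RandomGraph.unimodularAutSet) ∧
      RandomGraph.IsQuasiInvariant μ ∧
      (∀ᵐ p ∂(RandomGraph.relCountingMeasure μ),
        p.1.1 ∈ RandomGraph.unimodularAutSet →
          RandomGraph.radonNikodymCocycle μ p = RandomGraph.modularCocycle p) :=
  ⟨fun h => ⟨h.ae_mem_unimodularAutSet, h.isQuasiInvariant,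
    h.radonNikodymCocycle_ae_eq.mono fun _ hp _ => hp⟩,
    fun ⟨h1, h2, h3⟩ => RandomGraph.isUnimodular_of_radonNikodymCocycle h1 h2 h3⟩
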